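/- Let $(V,g)$ be a $4$-dimensional Euclidean vector space with an orthonormal basis $(e_0,e_1,e_2,e_3)$, and let $S^3\subset V$ be the unit sphere with the round metric and Levi-Civita connection $\nabla$. A Killing tensor is a smooth field $K$ of symmetric bilinear forms (equivalently, via $g$, of symmetric endomorphisms) on the tangent spaces of $S^3$ with $\nabla_{(\gamma}K_{\alpha\beta)}=0$. It is called integrable if its Nijenhuis torsion $N^\alpha{}_{\beta\gamma}=K^\alpha{}_\delta\nabla_{[\gamma}K^\delta{}_{\beta]}+\nabla_\delta K^\alpha{}_{[\gamma}K^\delta{}_{\beta]}$ satisfies $$N^\delta{}_{[\beta\gamma}g_{\alpha]\delta}=0,\qquad N^\delta{}_{[\beta\gamma}K_{\alpha]\delta}=0,\qquad N^\delta{}_{[\beta\gamma}K_{\alpha]\varepsilon}K^\varepsilon{}_\delta=0 .$$ An algebraic curvature tensor on $V$ is a $4$-linear form $R$ with the symmetries of a Riemannian curvature tensor (antisymmetry in each pair, pair symmetry, Bianchi identity). Every such $R$ defines a Killing tensor $K_x(v,w)=R(x,v,x,w)$ for $x\in S^3$, $v,w\in T_xS^3$, and $R$ is called its algebraic curvature tensor.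 Call $R$ diagonal if $R_{ijkl}=R(e_i,e_j,e_k,e_l)=0$ unless $\{i,j\}=\{k,l\}$. The diagonal algebraic curvature tensors are parametrised bijectively by $(w,t,s)\in\mathbb R^3\times\mathbb R^3\times\mathbb R$ with $w_1+w_2+w_3=0$, through $$R_{0\alpha0\alpha}=w_\alpha+t_\alpha+\tfrac s{12},\qquad R_{\beta\gamma\beta\gamma}=w_\alpha-t_\alpha+\tfrac s{12}$$ for the cyclic permutations $(\alpha,\beta,\gamma)$ of $(1,2,3)$. To such a tensor associate the matrix $$M=\begin{pmatrix}\Delta_1&-t_3&t_2\\ t_3&\Delta_2&-t_1\\ -t_2&t_1&\Delta_3\end{pmatrix},\qquad \Delta_1=w_2-w_3,\quad \Delta_2=w_3-w_1,\quad \Delta_3=w_1-w_2 .$$ 1. A Killing tensor on $S^3$ with diagonal algebraic curvature tensor is integrable if and only if its matrix $M$ has zero trace and zero determinant. 2. Let $\mathcal A\cong\mathbb R^5$ be the space of real $3\times3$ matrices whose symmetric part is diagonal and trace free. The classes $[M]$ of the nonzero matrices $M$ of integrable Killing tensors with diagonal algebraic curvature tensor form exactly the projective variety $\{[M]\in\mathbb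 P\mathcal A\cong\mathbb P^4:\det M=0\}$, the zero locus of a nonzero cubic form (the Killing-Stäckel variety). The group of rotations of the regular octahedron with vertices $\pm e_i$ in $\mathbb R^3$ (with its faces coherently oriented), which is isomorphic to the symmetric group $S_4$, acts on this variety by conjugation, $[M]\mapsto[QMQ^{-1}]$. 3. Let $R,R'$ be diagonal algebraic curvature tensors with parameters $(w,t,s)$, $(w',t',s')$ and matrices $M,M'$. Then $R$ and $R'$ are equivalent under the isometry group $O(V)$ of $S^3$ if and only if $s=s'$ and $M'=\operatorname{sgn}(Q)\,QMQ^{-1}$ for some element $Q$ of the octahedral rotation group, where $\operatorname{sgn}$ is the sign character of $S_4$. In particular, if $M,M'\neq0$, then $R$ and $R'$ are equivalent modulo isometries, multiplication by nonzero constants and addition of multiples of the algebraic curvature tensor $g(a,c)g(b,d)-g(a,d)g(b,c)$ of the metric if and only if the points $[M]$ and $[M']$ of $\mathbb P^4$ are equivalent under the conjugation action of $S_4$. -/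

import Mathlib

open scoped ContDiff LinearAlgebra.Projectivization

noncomputable section

namespace SphereKilling

section Tensors

variable {V : Type*} [NormedAddCommGroup V] [InnerProductSpace ℝ V]

/-- The tangent space `T_x S` of the unit sphere `S ⊂ V` at `x`, as the subspace `x^⊥` of `V`. -/
abbrev Tan (x : V) : Submodule ℝ V := (ℝ ∙ x)ᗮ

/-- A field of endomorphisms of the tangent spaces of the unit sphere of `V`. -/
abbrev EndoField (V : Type*) [NormedAddCommGroup V] [InnerProductSpace ℝ V] : Type _ :=
  ∀ x : Metric.sphere (0 : V) 1, Tan (x : V) →ₗ[ℝ] Tan (x : V)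

/-- The radial projection of a nonzero vector to the unit sphere. -/
def radial (y : V) (hy : y ≠ 0) : Metric.sphere (0 : V) 1 :=
  ⟨‖y‖⁻¹ • y, by simp [norm_smul, hy]⟩

open Classical in
/-- The extension of an endomorphism field `K` to `V ∖ {0}`: at `y` it is `K` at the radial
projection `x` of `y`, extended from `T_x S` to `V` by first projecting orthogonally to `T_x S`.
(At `y = 0` the value is a dummy.) -/
def extend (K : EndoField V) (v y : V) : V :=
  if hy : y ≠ 0 then
    (K (radial y hy) ((Tan (radial y hy : V)).orthogonalProjectionOnto v) : V)
  else 0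

/-- The covariant derivative `(∇_u K) v` of an endomorphism field of the unit sphere with respect
to the Levi-Civita connection of the round metric.  The Levi-Civita connection of a submanifold of
a Euclidean space is the tangential part of the directional derivative, so with a tangent field
`X` through `v`, `(∇_u K) v = ∇_u (K X) - K (∇_u X)` is the tangential part of the derivative of
the extension above in the direction `u`, with `v` kept constant. -/
def covDeriv (K : EndoField V) (x : Metric.sphere (0 : V) 1) (u v : Tan (x : V)) : Tan (x : V) :=
  (Tan (x : V)).orthogonalProjectionOnto (fderiv ℝ (extend K (v : V)) (x : V) (u : V))

/-- A Killing tensor on the unit sphere, regarded as a field of endomorphisms: a smooth field of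
symmetric endomorphisms such that the complete symmetrisation of its covariant derivative
vanishes. -/
structure IsKillingTensor (K : EndoField V) : Prop where
  smooth : ∀ v : V, ContDiffOn ℝ ∞ (extend K v) {0}ᶜ
  symm : ∀ (x : Metric.sphere (0 : V) 1) (v w : Tan (x : V)), inner ℝ (K x v) w = inner ℝ v (K x w)
  killing : ∀ (x : Metric.sphere (0 : V) 1) (v : Fin 3 → Tan (x : V)),
    ∑ σ : Equiv.Perm (Fin 3), inner ℝ (covDeriv K x (v (σ 0)) (v (σ 1))) (v (σ 2)) = 0

/-- The Nijenhuis torsion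
`N^α_{βγ} = K^α_δ ∇_{[γ} K^δ_{β]} + ∇_δ K^α_{[γ} K^δ_{β]}`, contracted with `v^β w^γ`. -/
def nijenhuis (K : EndoField V) (x : Metric.sphere (0 : V) 1) (v w : Tan (x : V)) : Tan (x : V) :=
  (1 / 2 : ℝ) • (K x (covDeriv K x w v) - K x (covDeriv K x v w))
    + (1 / 2 : ℝ) • (covDeriv K x (K x v) w - covDeriv K x (K x w) v)

/-- The Nijenhuis integrability conditions: the complete antisymmetrisations in `α, β, γ` of
`N^δ_{βγ} g_{αδ}`, `N^δ_{βγ} K_{αδ}` and `N^δ_{βγ} K_{αε} K^ε_δ` vanish at every point of the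
sphere. -/
structure IsIntegrable (K : EndoField V) : Prop where
  cond_metric : ∀ (x : Metric.sphere (0 : V) 1) (v : Fin 3 → Tan (x : V)),
    ∑ σ : Equiv.Perm (Fin 3), ((Equiv.Perm.sign σ : ℤ) : ℝ) *
      inner ℝ (v (σ 0)) (nijenhuis K x (v (σ 1)) (v (σ 2))) = 0
  cond_killing : ∀ (x : Metric.sphere (0 : V) 1) (v : Fin 3 → Tan (x : V)),
    ∑ σ : Equiv.Perm (Fin 3), ((Equiv.Perm.sign σ : ℤ) : ℝ) *
      inner ℝ (K x (v (σ 0))) (nijenhuis K x (v (σ 1)) (v (σ 2))) = 0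
  cond_square : ∀ (x : Metric.sphere (0 : V) 1) (v : Fin 3 → Tan (x : V)),
    ∑ σ : Equiv.Perm (Fin 3), ((Equiv.Perm.sign σ : ℤ) : ℝ) *
      inner ℝ (K x (v (σ 0))) (K x (nijenhuis K x (v (σ 1)) (v (σ 2)))) = 0

/-- Covariant tensors of rank four on `V`. -/
abbrev FourTensor (V : Type*) [NormedAddCommGroup V] [InnerProductSpace ℝ V] : Type _ :=
  V →ₗ[ℝ] V →ₗ[ℝ] V →ₗ[ℝ] V →ₗ[ℝ] ℝ

/-- Algebraic curvature tensors on `V`. -/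
structure IsAlgCurv (R : FourTensor V) : Prop where
  antisymm_left : ∀ a b c d, R b a c d = -R a b c d
  antisymm_right : ∀ a b c d, R a b d c = -R a b c d
  pair_symm : ∀ a b c d, R c d a b = R a b c d
  bianchi : ∀ a b c d, R a b c d + R a c d b + R a d b c = 0

/-- `R` is the algebraic curvature tensor of the symmetric tensor field `K` on the sphere:
`K_x(v, w) = R(x, v, x, w)`. -/
def IsCurvatureOf (R : FourTensor V) (K : EndoField V) : Prop :=
  ∀ (x : Metric.sphere (0 : V) 1) (v w : Tan (x : V)), inner ℝ (K x v) w = R (x : V) (v : V) (x : V) (w : V)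

/-- `R` is diagonal in the basis `e`: `R_{ijkl} = 0` unless `{i, j} = {k, l}`. -/
def IsDiagonal (e : OrthonormalBasis (Fin 4) ℝ V) (R : FourTensor V) : Prop :=
  ∀ i j k l : Fin 4, ({i, j} : Finset (Fin 4)) ≠ {k, l} → R (e i) (e j) (e k) (e l) = 0

/-- The parametrisation of the diagonal entries by `(w, t, s)` with `w₁ + w₂ + w₃ = 0`.
The indices `1, 2, 3` of the basis correspond to `α : Fin 3` through `Fin.succ`, and
`(α, α + 1, α + 2)` (modulo 3) runs through the cyclic permutations. -/
structure HasParams (e : OrthonormalBasis (Fin 4) ℝ V) (R : FourTensor V)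
    (w t : Fin 3 → ℝ) (s : ℝ) : Prop where
  sum_zero : w 0 + w 1 + w 2 = 0
  time : ∀ α : Fin 3, R (e 0) (e α.succ) (e 0) (e α.succ) = w α + t α + s / 12
  space : ∀ α : Fin 3, R (e (α + 1).succ) (e (α + 2).succ) (e (α + 1).succ) (e (α + 2).succ) =
    w α - t α + s / 12

/-- `R'` is the image of `R` under an isometry of the sphere, i.e. an element of `O(V)`. -/
def IsometryEquivalent (R R' : FourTensor V) : Prop :=
  ∃ U : V ≃ₗᵢ[ℝ] V, ∀ a b c d, R' (U a) (U b) (U c) (U d) = R a b c d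

/-- `R'` is obtained from `R` by an isometry of the sphere, multiplication with a nonzero constant
and addition of a multiple of the algebraic curvature tensor
`g(a, c) g(b, d) - g(a, d) g(b, c)` of the metric. -/
def EquivalentModMetricAndScalars (R R' : FourTensor V) : Prop :=
  ∃ (U : V ≃ₗᵢ[ℝ] V) (r : ℝ) (l : ℝ), r ≠ 0 ∧ ∀ a b c d,
    R' (U a) (U b) (U c) (U d) =
      r * R a b c d + l * (inner ℝ a c * inner ℝ b d - inner ℝ a d * inner ℝ b c)

end Tensors

section Matrices

/-- The matrix attached to `(w, t)`. -/
def ksMatrix (w t : Fin 3 → ℝ) : Matrix (Fin 3) (Fin 3) ℝ :=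
  !![w 1 - w 2, -t 2, t 1;
     t 2, w 2 - w 0, -t 0;
     -t 1, t 0, w 0 - w 1]

/-- The space of 3 × 3 matrices whose symmetric part is diagonal and trace free. -/
def ksSpace : Submodule ℝ (Matrix (Fin 3) (Fin 3) ℝ) where
  carrier := {M | (∀ i j, i ≠ j → M i j + M j i = 0) ∧ M.trace = 0}
  add_mem' := by
    rintro M N ⟨h1, h2⟩ ⟨h3, h4⟩
    refine ⟨fun i j hij => ?_, by rw [Matrix.trace_add, h2, h4, add_zero]⟩
    have := h1 i j hij
    have := h3 i j hij
    simp only [Matrix.add_apply]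
    linarith
  zero_mem' := by simp
  smul_mem' := by
    rintro c M ⟨h1, h2⟩
    refine ⟨fun i j hij => ?_, by rw [Matrix.trace_smul, h2, smul_zero]⟩
    simp only [Matrix.smul_apply, smul_eq_mul]
    rw [← mul_add, h1 i j hij, mul_zero]

theorem ksMatrix_mem (w t : Fin 3 → ℝ) : ksMatrix w t ∈ ksSpace := by
  refine ⟨fun i j hij => ?_, ?_⟩
  · fin_cases i <;> fin_cases j <;> simp [ksMatrix] at hij ⊢
  · simp [ksMatrix, Matrix.trace_fin_three]

/-- The matrix attached to `(w, t)`, as an element of `ksSpace`. -/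
def ksElem (w t : Fin 3 → ℝ) : ksSpace := ⟨ksMatrix w t, ksMatrix_mem w t⟩

/-- The Killing-Stäckel variety in `ℙ(ksSpace)`. -/
def ksVariety : Set (ℙ ℝ ksSpace) := {p | (p.rep : Matrix (Fin 3) (Fin 3) ℝ).det = 0}

/-- The vertices `±e_i` of the octahedron. -/
def octahedron : Set (Fin 3 → ℝ) :=
  {v | ∃ i : Fin 3, v = Pi.single i 1 ∨ v = -Pi.single i 1}

/-- The group of rotations of `ℝ³` which preserve the octahedron with vertices `±e_i`. -/
def octGroup : Subgroup (Matrix.specialOrthogonalGroup (Fin 3) ℝ) where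
  carrier := {Q | (fun v => (Q : Matrix (Fin 3) (Fin 3) ℝ).mulVec v) '' octahedron = octahedron}
  mul_mem' := by
    intro P Q hP hQ
    simp only [Set.mem_ofPred_eq] at hP hQ ⊢
    conv_rhs => rw [← hP, ← hQ, Set.image_image]
    simp [Matrix.mulVec_mulVec]
  one_mem' := by simp
  inv_mem' := by
    intro Q hQ
    simp only [Set.mem_ofPred_eq] at hQ ⊢
    conv_lhs => rw [← hQ, Set.image_image]
    have h : ((Q⁻¹ : Matrix.specialOrthogonalGroup (Fin 3) ℝ) : Matrix (Fin 3) (Fin 3) ℝ) *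
        (Q : Matrix (Fin 3) (Fin 3) ℝ) = 1 := by
      rw [← Submonoid.coe_mul, inv_mul_cancel, Submonoid.coe_one]
    simp [Matrix.mulVec_mulVec, h]

/-- The underlying 3 × 3 matrix of an element of `octGroup`. -/
def octMat (Q : octGroup) : Matrix (Fin 3) (Fin 3) ℝ := (Q : Matrix.specialOrthogonalGroup (Fin 3) ℝ)

theorem octMat_one : octMat 1 = 1 := rfl

theorem octMat_mul (P Q : octGroup) : octMat (P * Q) = octMat P * octMat Q := rfl

theorem octMat_transpose_mul (Q : octGroup) : (octMat Q).transpose * octMat Q = 1 := by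
  have h := (Matrix.mem_specialOrthogonalGroup_iff.1 Q.1.2).1
  exact (Matrix.mem_orthogonalGroup_iff' _ _).1 h

theorem octMat_col (Q : octGroup) {i j : Fin 3} (hij : i ≠ j) (k : Fin 3) :
    octMat Q i k * octMat Q j k = 0 := by
  have hQ : (fun v => (octMat Q).mulVec v) '' octahedron = octahedron := Q.2
  have hm : (octMat Q).mulVec (Pi.single k 1) ∈ octahedron := by
    rw [← hQ]
    exact ⟨_, ⟨k, Or.inl rfl⟩, rfl⟩
  obtain ⟨l, hl⟩ := hm
  have hi := fun m => congrFun (Matrix.mulVec_single_one (octMat Q) k) m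
  simp only [Matrix.col_apply] at hi
  rw [← hi i, ← hi j]
  by_cases h : i = l
  · have : j ≠ l := fun h' => hij (h.trans h'.symm)
    rcases hl with hl | hl <;> simp [hl, this]
  · rcases hl with hl | hl <;> simp [hl, h]

theorem conj_mem (Q : octGroup) {M : Matrix (Fin 3) (Fin 3) ℝ} (hM : M ∈ ksSpace) :
    octMat Q * M * (octMat Q).transpose ∈ ksSpace := by
  obtain ⟨h1, h2⟩ := hM
  refine ⟨fun i j hij => ?_, ?_⟩
  · have h01 := h1 0 1 (by decide)
    have h02 := h1 0 2 (by decide)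
    have h12 := h1 1 2 (by decide)
    have c0 := octMat_col Q hij 0
    have c1 := octMat_col Q hij 1
    have c2 := octMat_col Q hij 2
    simp only [Matrix.mul_apply, Fin.sum_univ_three, Matrix.transpose_apply]
    linear_combination
      (octMat Q i 0 * octMat Q j 1 + octMat Q i 1 * octMat Q j 0) * h01
      + (octMat Q i 0 * octMat Q j 2 + octMat Q i 2 * octMat Q j 0) * h02
      + (octMat Q i 1 * octMat Q j 2 + octMat Q i 2 * octMat Q j 1) * h12
      + 2 * M 0 0 * c0 + 2 * M 1 1 * c1 + 2 * M 2 2 * c2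
  · rw [Matrix.trace_mul_comm, ← Matrix.mul_assoc, octMat_transpose_mul, Matrix.one_mul, h2]

/-- The octahedral group acts linearly on `ksSpace` by conjugation, `Q • M = Q M Qᵀ = Q M Q⁻¹`;
this induces Mathlib's action of the group on the projective space `ℙ(ksSpace)`. -/
instance : DistribMulAction octGroup ksSpace where
  smul Q M := ⟨octMat Q * M * (octMat Q).transpose, conj_mem Q M.2⟩
  one_smul M := Subtype.ext (by
    change octMat 1 * (M : Matrix (Fin 3) (Fin 3) ℝ) * (octMat 1).transpose = M
    simp [octMat_one])
  mul_smul P Q M := Subtype.ext (by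
    change octMat (P * Q) * (M : Matrix (Fin 3) (Fin 3) ℝ) * (octMat (P * Q)).transpose =
      octMat P * (octMat Q * M * (octMat Q).transpose) * (octMat P).transpose
    simp [octMat_mul, Matrix.transpose_mul, Matrix.mul_assoc])
  smul_zero Q := Subtype.ext (by
    change octMat Q * (0 : Matrix (Fin 3) (Fin 3) ℝ) * (octMat Q).transpose = 0
    simp)
  smul_add Q M N := Subtype.ext (by
    change octMat Q * ((M : Matrix (Fin 3) (Fin 3) ℝ) + N) * (octMat Q).transpose =
      octMat Q * M * (octMat Q).transpose + octMat Q * N * (octMat Q).transpose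
    simp [mul_add, add_mul])

instance : SMulCommClass octGroup ℝ ksSpace where
  smul_comm Q c M := Subtype.ext (by
    change octMat Q * (c • (M : Matrix (Fin 3) (Fin 3) ℝ)) * (octMat Q).transpose =
      c • (octMat Q * M * (octMat Q).transpose)
    simp)

end Matrices

end SphereKilling

end

open SphereKilling
open scoped LinearAlgebra.Projectivization

/-! Integrability. For `K` with curvature tensor `R`, the extension of `K` to `V ∖ {0}` is `|y|⁻²
R(y, v, y, ·)`, so `⟨(∇_u K) v, w⟩ = R(u, v, x, w) + R(x, v, u, w)` and the Nijenhuis conditions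
become algebraic in `R`. Each is an alternating trilinear form on a three-dimensional tangent space,
hence a single number at each point. In an orthonormal frame let `κ` be the matrix of `K` and `Λ`
that of `R(b_{a+1}, b_{a+2}, x, b_c)`; `sum_sign_nijForm_frame` writes the number through traces of
products of `κ` and `Λ`, with `tr Λ = 0` by the Bianchi identity.

For diagonal `R`, regard `V` as the quaternions and use the frame `ix, jx, kx`. The traces become
polynomials in the coordinates of `x`: `tr(κΛᵀ) = 0` and `tr(κ²Λᵀ) = 2 det M · x₀x₁x₂x₃`. The first
condition is then automatic, the second is a multiple of `det M`, and Cayley-Hamilton reduces the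
third to the second. The trace of `M` always vanishes.

Equivalence. Attach to the four basis indices the vertices of a regular tetrahedron in `ℝ³`. The
entries `R_ijij` are then expressions in `w`, `t` and these vertices (`paramCoeff_eq`), so a
permutation of the basis acts on `(w, t)` through the isometry group of the tetrahedron. Multiplying
each such isometry by its determinant gives the rotations of the octahedron; this is the isomorphism
with `S₄` and the source of the sign character.

Conversely, invariants of `O(V)` recover the parameters up to this group
(`exists_signedPerm_of_isometry`): `s` is the trace of the Ricci contraction, `t₀t₁t₂` comes from
the cube of its trace free part, and the unordered triple of pairs `(w_α, t_α²)` comes from the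
power sums of `w_α + c t_α²` for generic `c`, which are traces of powers of one equivariant operator
on two-tensors. The product `t₀t₁t₂` settles the signs. -/

namespace SphereKilling

/-! ### Diagonal algebraic curvature tensors and their parameters -/

section DiagonalTensors

variable {V : Type*} [NormedAddCommGroup V] [InnerProductSpace ℝ V]

/-- The diagonal four-tensor `∑ r_ij (eⁱ ⊗ eʲ ⊗ eⁱ ⊗ eʲ - eⁱ ⊗ eʲ ⊗ eʲ ⊗ eⁱ)`. -/
noncomputable def diagTensor (e : OrthonormalBasis (Fin 4) ℝ V) (r : Fin 4 → Fin 4 → ℝ) :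
    FourTensor V :=
  ∑ i, ∑ j,
    (r i j • (e.toBasis.coord i).smulRight ((e.toBasis.coord j).smulRight
        ((e.toBasis.coord i).smulRight (e.toBasis.coord j))) +
      (-r i j) • (e.toBasis.coord i).smulRight ((e.toBasis.coord j).smulRight
        ((e.toBasis.coord j).smulRight (e.toBasis.coord i))))

theorem diagTensor_apply (e : OrthonormalBasis (Fin 4) ℝ V) (r : Fin 4 → Fin 4 → ℝ)
    (a b c d : V) :
    diagTensor e r a b c d = ∑ i, ∑ j, r i j *
      (e.repr a i * e.repr b j * (e.repr c i * e.repr d j) -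
        e.repr a i * e.repr b j * (e.repr c j * e.repr d i)) := by
  simp only [diagTensor, LinearMap.sum_apply, LinearMap.smul_apply, LinearMap.add_apply,
    LinearMap.smulRight_apply, Module.Basis.coord_apply, OrthonormalBasis.coe_toBasis_repr_apply,
    smul_eq_mul]
  refine Finset.sum_congr rfl fun i _ => Finset.sum_congr rfl fun j _ => ?_
  ring

theorem repr_basis (e : OrthonormalBasis (Fin 4) ℝ V) (i j : Fin 4) :
    e.repr (e i) j = if j = i then 1 else 0 := by
  rw [e.repr_self, PiLp.single_apply]

theorem diagTensor_basis (e : OrthonormalBasis (Fin 4) ℝ V) (r : Fin 4 → Fin 4 → ℝ)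
    (i j k l : Fin 4) :
    diagTensor e r (e i) (e j) (e k) (e l) =
      if i = k ∧ j = l then (if i = j then 0 else r i j)
      else if i = l ∧ j = k then -r i j else 0 := by
  rw [diagTensor_apply]
  simp only [repr_basis]
  rw [Finset.sum_eq_single i (fun m _ hm => by simp [hm]) (by simp),
    Finset.sum_eq_single j (fun m _ hm => by simp [hm]) (by simp)]
  by_cases h1 : i = k <;> by_cases h2 : j = l <;> by_cases h3 : i = l <;> by_cases h4 : j = k <;>
    simp_all [eq_comm]

theorem isAlgCurv_diagTensor (e : OrthonormalBasis (Fin 4) ℝ V) {r : Fin 4 → Fin 4 → ℝ}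
    (hr : ∀ i j, r i j = r j i) : IsAlgCurv (diagTensor e r) := by
  refine ⟨fun a b c d => ?_, fun a b c d => ?_, fun a b c d => ?_, fun a b c d => ?_⟩
  · simp only [diagTensor_apply]
    rw [Finset.sum_comm]
    simp only [← Finset.sum_neg_distrib]
    refine Finset.sum_congr rfl fun i _ => Finset.sum_congr rfl fun j _ => ?_
    rw [hr]; ring
  · simp only [diagTensor_apply]
    simp only [← Finset.sum_neg_distrib]
    refine Finset.sum_congr rfl fun i _ => Finset.sum_congr rfl fun j _ => ?_
    ring
  · simp only [diagTensor_apply, mul_sub, Finset.sum_sub_distrib]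
    congr 1
    · refine Finset.sum_congr rfl fun i _ => Finset.sum_congr rfl fun j _ => ?_
      ring
    · rw [Finset.sum_comm]
      refine Finset.sum_congr rfl fun i _ => Finset.sum_congr rfl fun j _ => ?_
      rw [hr]; ring
  · simp only [diagTensor_apply, ← Finset.sum_add_distrib]
    refine Finset.sum_eq_zero fun i _ => Finset.sum_eq_zero fun j _ => ?_
    ring

theorem isDiagonal_diagTensor (e : OrthonormalBasis (Fin 4) ℝ V) (r : Fin 4 → Fin 4 → ℝ) :
    IsDiagonal e (diagTensor e r) := by
  intro i j k l h
  rw [diagTensor_basis, if_neg, if_neg]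
  · rintro ⟨rfl, rfl⟩
    exact h (Finset.pair_comm _ _)
  · rintro ⟨rfl, rfl⟩
    exact h rfl

/-- The diagonal entries `R_ijij` prescribed by the parameters `(w, t, s)`. -/
noncomputable def paramCoeff (w t : Fin 3 → ℝ) (s : ℝ) : Fin 4 → Fin 4 → ℝ :=
  ![![0, w 0 + t 0 + s / 12, w 1 + t 1 + s / 12, w 2 + t 2 + s / 12],
    ![w 0 + t 0 + s / 12, 0, w 2 - t 2 + s / 12, w 1 - t 1 + s / 12],
    ![w 1 + t 1 + s / 12, w 2 - t 2 + s / 12, 0, w 0 - t 0 + s / 12],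
    ![w 2 + t 2 + s / 12, w 1 - t 1 + s / 12, w 0 - t 0 + s / 12, 0]]

theorem paramCoeff_symm (w t : Fin 3 → ℝ) (s : ℝ) (i j : Fin 4) :
    paramCoeff w t s i j = paramCoeff w t s j i := by
  fin_cases i <;> fin_cases j <;> rfl

theorem FourTensor.ext_basis (e : OrthonormalBasis (Fin 4) ℝ V) {R R' : FourTensor V}
    (h : ∀ i j k l, R (e i) (e j) (e k) (e l) = R' (e i) (e j) (e k) (e l)) : R = R' := by
  refine e.toBasis.ext fun i => e.toBasis.ext fun j => e.toBasis.ext fun k =>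
    e.toBasis.ext fun l => ?_
  simpa using h i j k l

theorem IsAlgCurv.swap_swap {R : FourTensor V} (hR : IsAlgCurv R) (a b c d : V) :
    R b a d c = R a b c d := by
  rw [hR.antisymm_left, hR.antisymm_right, neg_neg]

theorem IsAlgCurv.self_left {R : FourTensor V} (hR : IsAlgCurv R) (a c d : V) :
    R a a c d = 0 := by
  linarith [hR.antisymm_left a a c d]

theorem IsAlgCurv.self_right {R : FourTensor V} (hR : IsAlgCurv R) (a b c : V) :
    R a b c c = 0 := by
  linarith [hR.antisymm_right a b c c]

theorem eq_diagTensor {e : OrthonormalBasis (Fin 4) ℝ V} {R : FourTensor V} (hR : IsAlgCurv R)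
    (hd : IsDiagonal e R) {r : Fin 4 → Fin 4 → ℝ}
    (hr : ∀ i j, i ≠ j → R (e i) (e j) (e i) (e j) = r i j) : R = diagTensor e r := by
  refine FourTensor.ext_basis e fun i j k l => ?_
  rw [diagTensor_basis]
  split_ifs with h1 h2 h2
  · obtain ⟨rfl, rfl⟩ := h1
    rw [h2, hR.self_left]
  · obtain ⟨rfl, rfl⟩ := h1
    exact hr _ _ h2
  · obtain ⟨rfl, rfl⟩ := h2
    rw [hR.antisymm_right, hr]
    rintro rfl
    exact h1 ⟨rfl, rfl⟩
  · by_cases h : ({i, j} : Finset (Fin 4)) = {k, l}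
    -- Equal two-element sets would fall under one of the two matchings excluded above, so only
    -- singletons remain.
    · have h0 : i = j ∨ k = l := by
        revert i j k l
        decide
      rcases h0 with rfl | rfl
      · exact hR.self_left _ _ _
      · exact hR.self_right _ _ _
    · exact hd i j k l h

theorem HasParams.apply_basis {e : OrthonormalBasis (Fin 4) ℝ V} {R : FourTensor V}
    {w t : Fin 3 → ℝ} {s : ℝ} (h : HasParams e R w t s) (hR : IsAlgCurv R) (i j : Fin 4) :
    R (e i) (e j) (e i) (e j) = paramCoeff w t s i j := by
  have ht := h.time
  have hs := h.space
  simp only [Fin.forall_fin_succ, Fin.forall_fin_zero, Fin.succ_zero_eq_one] at ht hs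
  have sw := fun i j => hR.swap_swap (e i) (e j) (e i) (e j)
  obtain ⟨t0, t1, t2, -⟩ := ht
  obtain ⟨s0, s1, s2, -⟩ := hs
  fin_cases i <;> fin_cases j <;> simp [paramCoeff, hR.self_left]
  · exact t0
  · exact t1
  · exact t2
  · rw [sw]; exact t0
  · exact s2
  · rw [sw]; exact s1
  · rw [sw]; exact t1
  · rw [sw]; exact s2
  · exact s0
  · rw [sw]; exact t2
  · exact s1
  · rw [sw]; exact s0

theorem HasParams.eq_diagTensor {e : OrthonormalBasis (Fin 4) ℝ V} {R : FourTensor V}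
    {w t : Fin 3 → ℝ} {s : ℝ} (h : HasParams e R w t s) (hR : IsAlgCurv R)
    (hd : IsDiagonal e R) : R = diagTensor e (paramCoeff w t s) :=
  SphereKilling.eq_diagTensor hR hd fun i j _ => h.apply_basis hR i j

theorem hasParams_diagTensor (e : OrthonormalBasis (Fin 4) ℝ V) {w : Fin 3 → ℝ}
    (hw : w 0 + w 1 + w 2 = 0) (t : Fin 3 → ℝ) (s : ℝ) :
    HasParams e (diagTensor e (paramCoeff w t s)) w t s := by
  refine ⟨hw, fun α => ?_, fun α => ?_⟩ <;> fin_cases α <;>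
    simp [diagTensor_basis, paramCoeff, Fin.ext_iff]

theorem HasParams.unique {e : OrthonormalBasis (Fin 4) ℝ V} {R : FourTensor V}
    {w t w' t' : Fin 3 → ℝ} {s s' : ℝ} (h : HasParams e R w t s) (h' : HasParams e R w' t' s') :
    w' = w ∧ t' = t ∧ s' = s := by
  have e1 := fun α => (h.time α).symm.trans (h'.time α)
  have e2 := fun α => (h.space α).symm.trans (h'.space α)
  have z := h.sum_zero
  have z' := h'.sum_zero
  have hs : s' = s := by linarith [e1 0, e1 1, e1 2, e2 0, e2 1, e2 2]
  exact ⟨funext fun α => by linarith [e1 α, e2 α], funext fun α => by linarith [e1 α, e2 α], hs⟩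

theorem exists_hasParams (e : OrthonormalBasis (Fin 4) ℝ V) (R : FourTensor V) :
    ∃ (w t : Fin 3 → ℝ) (s : ℝ), HasParams e R w t s := by
  let a : Fin 3 → ℝ := fun α => R (e 0) (e α.succ) (e 0) (e α.succ)
  let b : Fin 3 → ℝ := fun α =>
    R (e (α + 1).succ) (e (α + 2).succ) (e (α + 1).succ) (e (α + 2).succ)
  -- The six diagonal entries add up to `s / 2`, since the `t_α` cancel and the `w_α` sum to zero.
  let s : ℝ := 2 * (a 0 + a 1 + a 2 + (b 0 + b 1 + b 2))
  refine ⟨fun α => (a α + b α) / 2 - s / 12, fun α => (a α - b α) / 2, s, ?_, fun α => ?_,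
    fun α => ?_⟩
  · simp only [s]; ring
  · change a α = _; ring
  · change b α = _; ring

theorem existsUnique_params (e : OrthonormalBasis (Fin 4) ℝ V) (R : FourTensor V) :
    ∃! p : (Fin 3 → ℝ) × (Fin 3 → ℝ) × ℝ, HasParams e R p.1 p.2.1 p.2.2 := by
  obtain ⟨w, t, s, h⟩ := exists_hasParams e R
  refine ⟨(w, t, s), h, fun p hp => ?_⟩
  obtain ⟨h1, h2, h3⟩ := h.unique hp
  exact Prod.ext h1 (Prod.ext h2 h3)

theorem existsUnique_diagonal (e : OrthonormalBasis (Fin 4) ℝ V) {w : Fin 3 → ℝ}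
    (hw : w 0 + w 1 + w 2 = 0) (t : Fin 3 → ℝ) (s : ℝ) :
    ∃! R : FourTensor V, IsAlgCurv R ∧ IsDiagonal e R ∧ HasParams e R w t s :=
  ⟨_, ⟨isAlgCurv_diagTensor e (paramCoeff_symm w t s), isDiagonal_diagTensor e _,
    hasParams_diagTensor e hw t s⟩, fun _ hR => hR.2.2.eq_diagTensor hR.1 hR.2.1⟩

end DiagonalTensors

/-! ### Sums over the symmetric group of three letters -/

section PermSums

theorem univ_perm_fin_three : (Finset.univ : Finset (Equiv.Perm (Fin 3))) =
    {1, Equiv.swap 0 1, Equiv.swap 0 2, Equiv.swap 1 2,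
      Equiv.swap 0 1 * Equiv.swap 1 2, Equiv.swap 1 2 * Equiv.swap 0 1} := by
  decide

theorem sum_perm_fin_three (f : Fin 3 → Fin 3 → Fin 3 → ℝ) :
    ∑ σ : Equiv.Perm (Fin 3), f (σ 0) (σ 1) (σ 2) =
      f 0 1 2 + f 1 2 0 + f 2 0 1 + f 1 0 2 + f 2 1 0 + f 0 2 1 := by
  rw [univ_perm_fin_three, Finset.sum_insert (by decide), Finset.sum_insert (by decide),
    Finset.sum_insert (by decide), Finset.sum_insert (by decide), Finset.sum_insert (by decide),
    Finset.sum_singleton]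
  change f 0 1 2 + (f 1 0 2 + (f 2 1 0 + (f 0 2 1 + (f 1 2 0 + f 2 0 1)))) = _
  ring

theorem sum_sign_perm_fin_three (f : Fin 3 → Fin 3 → Fin 3 → ℝ) :
    ∑ σ : Equiv.Perm (Fin 3), ((Equiv.Perm.sign σ : ℤ) : ℝ) * f (σ 0) (σ 1) (σ 2) =
      f 0 1 2 + f 1 2 0 + f 2 0 1 - f 1 0 2 - f 2 1 0 - f 0 2 1 := by
  rw [univ_perm_fin_three, Finset.sum_insert (by decide), Finset.sum_insert (by decide),
    Finset.sum_insert (by decide), Finset.sum_insert (by decide), Finset.sum_insert (by decide),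
    Finset.sum_singleton]
  have h01 : Equiv.Perm.sign (Equiv.swap (0 : Fin 3) 1) = -1 := by decide
  have h02 : Equiv.Perm.sign (Equiv.swap (0 : Fin 3) 2) = -1 := by decide
  have h12 : Equiv.Perm.sign (Equiv.swap (1 : Fin 3) 2) = -1 := by decide
  simp only [Equiv.Perm.sign_mul, Equiv.Perm.sign_one, h01, h02, h12]
  change ((1 : ℤ) : ℝ) * f 0 1 2 + (((-1 : ℤ) : ℝ) * f 1 0 2 + (((-1 : ℤ) : ℝ) * f 2 1 0 +
    (((-1 : ℤ) : ℝ) * f 0 2 1 + (((1 : ℤ) : ℝ) * f 1 2 0 + ((1 : ℤ) : ℝ) * f 2 0 1)))) = _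
  push_cast
  ring

end PermSums

/-! ### The Killing tensor of an algebraic curvature tensor -/

section KillingTensors

theorem norm_coe_sphere {E : Type*} [NormedAddCommGroup E] (x : Metric.sphere (0 : E) 1) :
    ‖(x : E)‖ = 1 := by simp

variable {V : Type*} [NormedAddCommGroup V] [InnerProductSpace ℝ V]

/-- The vector dual to the linear form `R a b c`. -/
noncomputable def curvVec (e : OrthonormalBasis (Fin 4) ℝ V) (R : FourTensor V) (a b c : V) : V :=
  ∑ i, R a b c (e i) • e i

theorem inner_curvVec (e : OrthonormalBasis (Fin 4) ℝ V) (R : FourTensor V) (a b c d : V) :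
    inner ℝ (curvVec e R a b c) d = R a b c d := by
  conv_rhs => rw [← e.sum_repr' d]
  simp [curvVec, sum_inner, inner_smul_left, mul_comm]

theorem inner_tan (x : V) (v : Tan x) : inner ℝ x (v : V) = 0 :=
  Submodule.mem_orthogonal_singleton_iff_inner_right.1 v.2

theorem coe_orthogonalProjectionOnto_tan (x : Metric.sphere (0 : V) 1) (v : V) :
    ((Tan (x : V)).orthogonalProjectionOnto v : V) = v - inner ℝ (x : V) v • (x : V) := by
  rw [Submodule.coe_orthogonalProjectionOnto_apply, Submodule.starProjection_orthogonal',
    ← Submodule.starProjection_unit_singleton ℝ (norm_coe_sphere x) v]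
  simp

theorem IsAlgCurv.apply_projection {R : FourTensor V} (hR : IsAlgCurv R)
    (x : Metric.sphere (0 : V) 1) (v w : V) :
    R x ((Tan (x : V)).orthogonalProjectionOnto v : V) x
      ((Tan (x : V)).orthogonalProjectionOnto w : V) = R x v x w := by
  rw [coe_orthogonalProjectionOnto_tan, coe_orthogonalProjectionOnto_tan]
  simp only [map_sub, map_smul, LinearMap.sub_apply, LinearMap.smul_apply, hR.self_left,
    hR.self_right, smul_zero, sub_zero]

/-- The projection to the tangent space may be dropped because `R(y, y, ·, ·) = 0`, and rescaling
the two arguments `y` to unit length gives the factor `|y|⁻²`. -/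
theorem extend_eq (e : OrthonormalBasis (Fin 4) ℝ V) {R : FourTensor V} {K : EndoField V}
    (hR : IsAlgCurv R) (hK : IsCurvatureOf R K) (v y : V) (hy : y ≠ 0) :
    extend K v y = (‖y‖ ^ 2)⁻¹ • curvVec e R y v y := by
  refine ext_inner_right ℝ fun w => ?_
  rw [extend, dif_pos hy, inner_smul_left, inner_curvVec,
    ← Submodule.inner_orthogonalProjectionOnto_eq_of_mem_left, hK, hR.apply_projection]
  simp [radial]
  ring

theorem contDiff_curvVec (e : OrthonormalBasis (Fin 4) ℝ V) (R : FourTensor V) (v : V) :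
    ContDiff ℝ ∞ (fun y => curvVec e R y v y) := by
  have h : ∀ w : V, (fun y => R y v y w) = fun y =>
      ∑ i, ∑ j, inner ℝ (e i) y * (inner ℝ (e j) y * R (e i) v (e j) w) := by
    intro w
    funext y
    conv_lhs => rw [← e.sum_repr' y]
    simp only [map_sum, map_smul, LinearMap.sum_apply, LinearMap.smul_apply, smul_eq_mul,
      Finset.mul_sum]
    rw [Finset.sum_comm]
    refine Finset.sum_congr rfl fun i _ => Finset.sum_congr rfl fun j _ => ?_
    ring
  unfold curvVec
  refine ContDiff.sum fun i _ => ContDiff.smul ?_ contDiff_const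
  rw [h]
  exact ContDiff.sum fun j _ => ContDiff.sum fun k _ =>
    (contDiff_const.inner ℝ contDiff_id).mul ((contDiff_const.inner ℝ contDiff_id).mul
      contDiff_const)

theorem contDiffOn_extend (e : OrthonormalBasis (Fin 4) ℝ V) {R : FourTensor V} {K : EndoField V}
    (hR : IsAlgCurv R) (hK : IsCurvatureOf R K) (v : V) :
    ContDiffOn ℝ ∞ (extend K v) {0}ᶜ := by
  have h : ContDiffOn ℝ ∞ (fun y => (‖y‖ ^ 2)⁻¹ • curvVec e R y v y) {0}ᶜ := by
    refine ContDiffOn.smul (ContDiffOn.inv ?_ fun y hy => ?_) (contDiff_curvVec e R v).contDiffOn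
    · exact (contDiff_norm_sq ℝ).contDiffOn
    · exact pow_ne_zero 2 (norm_ne_zero_iff.2 hy)
  exact h.congr fun y hy => extend_eq e hR hK v y hy

/-- For `u` tangent at `x`, `|x + τu|² = 1 + τ²|u|²` is stationary at `τ = 0`. Hence the factor
`|y|⁻²` contributes nothing and only the linear term of the quadratic `R(y, v, y, ·)` survives. -/
theorem fderiv_extend (e : OrthonormalBasis (Fin 4) ℝ V) {R : FourTensor V} {K : EndoField V}
    (hR : IsAlgCurv R) (hK : IsCurvatureOf R K) (x : Metric.sphere (0 : V) 1) (u : Tan (x : V))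
    (v : V) :
    fderiv ℝ (extend K v) x u = curvVec e R u v x + curvVec e R x v u := by
  have hx : (x : V) ≠ 0 := by
    intro h
    simpa [h] using norm_coe_sphere x
  have hd : DifferentiableAt ℝ (extend K v) x :=
    ((contDiffOn_extend e hR hK v).contDiffAt (isOpen_compl_singleton.mem_nhds hx)).differentiableAt
      (by simp)
  have h1 := hd.hasFDerivAt.hasLineDerivAt (u : V)
  have hn : ∀ τ : ℝ, ‖(x : V) + τ • (u : V)‖ ^ 2 = 1 + τ ^ 2 * ‖(u : V)‖ ^ 2 := by
    intro τ
    rw [norm_add_sq_real, inner_smul_right, inner_tan, norm_smul, norm_coe_sphere, mul_pow,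
      Real.norm_eq_abs, sq_abs]
    ring
  have hv : ∀ τ : ℝ, (x : V) + τ • (u : V) ≠ 0 := by
    intro τ h
    have := hn τ
    rw [h, norm_zero] at this
    nlinarith [sq_nonneg (τ * ‖(u : V)‖)]
  have h2 : (fun τ : ℝ => extend K v (x + τ • (u : V))) = fun τ =>
      (1 + τ ^ 2 * ‖(u : V)‖ ^ 2)⁻¹ • (curvVec e R x v x +
        τ • (curvVec e R u v x + curvVec e R x v u) + τ ^ 2 • curvVec e R u v u) := by
    funext τ
    rw [extend_eq e hR hK v _ (hv τ), hn]
    congr 1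
    refine ext_inner_right ℝ fun w => ?_
    simp only [inner_add_left, inner_smul_left, inner_curvVec, map_add, map_smul,
      LinearMap.add_apply, LinearMap.smul_apply, smul_eq_mul, RCLike.conj_to_real]
    ring
  have hpow : HasDerivAt (fun τ : ℝ => τ ^ 2) 0 0 := by
    simpa using hasDerivAt_pow 2 (0 : ℝ)
  have h3 : HasDerivAt (fun τ : ℝ => (1 + τ ^ 2 * ‖(u : V)‖ ^ 2)⁻¹ • (curvVec e R x v x +
        τ • (curvVec e R u v x + curvVec e R x v u) + τ ^ 2 • curvVec e R u v u))
      (curvVec e R u v x + curvVec e R x v u) 0 := by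
    have ha := ((hpow.mul_const (‖(u : V)‖ ^ 2)).const_add 1).fun_inv (by simp)
    have hb := (((hasDerivAt_id (0 : ℝ)).smul_const
      (curvVec e R u v x + curvVec e R x v u)).const_add (curvVec e R x v x)).add (hpow.smul_const (curvVec e R u v u))
    refine (ha.smul hb).congr_deriv ?_
    simp
  have h4 : HasDerivAt (fun τ : ℝ => extend K v (x + τ • (u : V)))
      (fderiv ℝ (extend K v) x u) 0 := h1
  rw [h2] at h4
  exact h4.unique h3

theorem inner_covDeriv (e : OrthonormalBasis (Fin 4) ℝ V) {R : FourTensor V} {K : EndoField V}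
    (hR : IsAlgCurv R) (hK : IsCurvatureOf R K) (x : Metric.sphere (0 : V) 1)
    (u v w : Tan (x : V)) :
    inner ℝ (covDeriv K x u v) w = R u v x w + R x v u w := by
  rw [covDeriv, real_inner_comm, Submodule.inner_orthogonalProjectionOnto_eq_of_mem_left,
    fderiv_extend e hR hK, real_inner_comm, inner_add_left, inner_curvVec, inner_curvVec]

theorem isKillingTensor (e : OrthonormalBasis (Fin 4) ℝ V) {R : FourTensor V} {K : EndoField V}
    (hR : IsAlgCurv R) (hK : IsCurvatureOf R K) : IsKillingTensor K where
  smooth := contDiffOn_extend e hR hK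
  symm x v w := by
    rw [hK, real_inner_comm, hK, hR.pair_symm]
  killing x v := by
    -- Each of the two terms of the covariant derivative is antisymmetric in two of the symmetrised
    -- arguments.
    simp only [inner_covDeriv e hR hK]
    rw [sum_perm_fin_three fun i j k => R (v i) (v j) x (v k) + R x (v j) (v i) (v k)]
    linarith [hR.antisymm_left (v 0) (v 1) x (v 2), hR.antisymm_left (v 1) (v 2) x (v 0),
      hR.antisymm_left (v 2) (v 0) x (v 1), hR.antisymm_right x (v 0) (v 1) (v 2),
      hR.antisymm_right x (v 1) (v 2) (v 0), hR.antisymm_right x (v 2) (v 0) (v 1)]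

/-- The field of endomorphisms `K_x v = R(x, v, x, ·)`. -/
noncomputable def curvField (e : OrthonormalBasis (Fin 4) ℝ V) {R : FourTensor V}
    (hR : IsAlgCurv R) : EndoField V := fun x =>
  { toFun := fun v => ⟨curvVec e R x v x, by
      rw [Submodule.mem_orthogonal_singleton_iff_inner_left, inner_curvVec, hR.self_right]⟩
    map_add' := fun v w => Subtype.ext <| ext_inner_right ℝ fun z => by
      simp [inner_add_left, inner_curvVec]
    map_smul' := fun c v => Subtype.ext <| ext_inner_right ℝ fun z => by
      simp [inner_smul_left, inner_curvVec] }

theorem isCurvatureOf_curvField (e : OrthonormalBasis (Fin 4) ℝ V) {R : FourTensor V}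
    (hR : IsAlgCurv R) : IsCurvatureOf R (curvField e hR) := fun _ _ _ => inner_curvVec e R _ _ _ _

theorem existsUnique_killingTensor (e : OrthonormalBasis (Fin 4) ℝ V) {R : FourTensor V}
    (hR : IsAlgCurv R) : ∃! K : EndoField V, IsKillingTensor K ∧ IsCurvatureOf R K := by
  refine ⟨curvField e hR, ⟨isKillingTensor e hR (isCurvatureOf_curvField e hR),
    isCurvatureOf_curvField e hR⟩, fun K hK => ?_⟩
  funext x
  refine LinearMap.ext fun v => ext_inner_right ℝ fun w => ?_
  rw [hK.2, isCurvatureOf_curvField]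

end KillingTensors

/-! ### The antisymmetrised Nijenhuis torsion as a trace -/

section NijenhuisForm

variable {V : Type*} [NormedAddCommGroup V] [InnerProductSpace ℝ V]

theorem inner_nijenhuis (e : OrthonormalBasis (Fin 4) ℝ V) {R : FourTensor V} {K : EndoField V}
    (hR : IsAlgCurv R) (hK : IsCurvatureOf R K) (x : Metric.sphere (0 : V) 1)
    (z v w : Tan (x : V)) :
    inner ℝ z (nijenhuis K x v w) =
      1 / 2 * (R w v x (K x z) + R x v w (K x z) - (R v w x (K x z) + R x w v (K x z))) +
      1 / 2 * (R (K x v) w x z + R x w (K x v) z - (R (K x w) v x z + R x v (K x w) z)) := by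
  have hs := (isKillingTensor e hR hK).symm x
  rw [real_inner_comm, nijenhuis, inner_add_left, inner_smul_left, inner_smul_left, inner_sub_left,
    inner_sub_left, hs, hs]
  simp only [inner_covDeriv e hR hK]
  simp

/-- The trilinear form `⟨L u, N(v, w)⟩` on a tangent space, where `N` is the Nijenhuis torsion of
the Killing tensor of `R`, whose value at `x` is `A`. -/
noncomputable def nijForm (R : FourTensor V) (x : V) (A L : Tan x →ₗ[ℝ] Tan x) :
    MultilinearMap ℝ (fun _ : Fin 3 => Tan x) ℝ where
  toFun u := 1 / 2 * (R (u 2) (u 1) x (A (L (u 0))) + R x (u 1) (u 2) (A (L (u 0))) -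
      (R (u 1) (u 2) x (A (L (u 0))) + R x (u 2) (u 1) (A (L (u 0))))) +
    1 / 2 * (R (A (u 1)) (u 2) x (L (u 0)) + R x (u 2) (A (u 1)) (L (u 0)) -
      (R (A (u 2)) (u 1) x (L (u 0)) + R x (u 1) (A (u 2)) (L (u 0))))
  map_update_add' := by
    intro inst u i a b
    obtain rfl : inst = instDecidableEqFin 3 := Subsingleton.elim _ _
    fin_cases i <;>
      simp only [Function.update_self, Function.update_of_ne, ne_eq, Fin.reduceEq, Fin.isValue,
        Fin.zero_eta, Fin.mk_one, Fin.reduceFinMk, not_false_eq_true, one_ne_zero, zero_ne_one,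
        map_add, LinearMap.add_apply, Submodule.coe_add] <;> ring
  map_update_smul' := by
    intro inst u i a b
    obtain rfl : inst = instDecidableEqFin 3 := Subsingleton.elim _ _
    fin_cases i <;>
      simp only [Function.update_self, Function.update_of_ne, ne_eq, Fin.reduceEq, Fin.isValue,
        Fin.zero_eta, Fin.mk_one, Fin.reduceFinMk, not_false_eq_true, one_ne_zero, zero_ne_one,
        map_smul, LinearMap.smul_apply, Submodule.coe_smul, smul_eq_mul] <;> ring

/-- In dimension three an alternating trilinear form is a multiple of the determinant, so testing it
on one basis suffices. -/
theorem sum_sign_multilinear_eq_zero {E : Type*} [AddCommGroup E] [Module ℝ E]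
    (b : Module.Basis (Fin 3) ℝ E) (f : MultilinearMap ℝ (fun _ : Fin 3 => E) ℝ)
    (h : ∑ σ : Equiv.Perm (Fin 3), ((Equiv.Perm.sign σ : ℤ) : ℝ) *
      f ![b (σ 0), b (σ 1), b (σ 2)] = 0) (v : Fin 3 → E) :
    ∑ σ : Equiv.Perm (Fin 3), ((Equiv.Perm.sign σ : ℤ) : ℝ) *
      f ![v (σ 0), v (σ 1), v (σ 2)] = 0 := by
  have key : ∀ v : Fin 3 → E, ∑ σ : Equiv.Perm (Fin 3), ((Equiv.Perm.sign σ : ℤ) : ℝ) *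
      f ![v (σ 0), v (σ 1), v (σ 2)] = MultilinearMap.alternatization f v := by
    intro v
    rw [MultilinearMap.alternatization_apply]
    refine Finset.sum_congr rfl fun σ _ => ?_
    rw [Units.smul_def, zsmul_eq_mul]
    congr 1
    rw [MultilinearMap.domDomCongr_apply]
    congr 1
    funext i
    fin_cases i <;> rfl
  rw [key] at h ⊢
  rw [AlternatingMap.eq_smul_basis_det b (MultilinearMap.alternatization f), h, zero_smul]
  rfl

/-- The alternating contraction of the Nijenhuis torsion in an orthonormal frame. -/
theorem sum_sign_nijForm_frame {R : FourTensor V} (hR : IsAlgCurv R) {x : V}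
    {A L : Tan x →ₗ[ℝ] Tan x} {b : Fin 3 → Tan x} {κ ℓ Λ : Matrix (Fin 3) (Fin 3) ℝ}
    (hA : ∀ a, A (b a) = ∑ c, κ a c • b c) (hL : ∀ a, L (b a) = ∑ c, ℓ a c • b c)
    (hΛ : ∀ a c, R (b (a + 1)) (b (a + 2)) x (b c) = Λ a c) :
    ∑ σ : Equiv.Perm (Fin 3), ((Equiv.Perm.sign σ : ℤ) : ℝ) *
        nijForm R x A L ![b (σ 0), b (σ 1), b (σ 2)] =
      -4 * (ℓ * κ * Λ.transpose).trace - 2 * (κ * ℓ * Λ.transpose).trace +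
        2 * κ.trace * (ℓ * Λ.transpose).trace + ℓ.trace * (κ * Λ.transpose).trace := by
  have d12 : ∀ c, R (b 1) (b 2) x (b c) = Λ 0 c := fun c => hΛ 0 c
  have d20 : ∀ c, R (b 2) (b 0) x (b c) = Λ 1 c := fun c => hΛ 1 c
  have d01 : ∀ c, R (b 0) (b 1) x (b c) = Λ 2 c := fun c => hΛ 2 c
  have d21 : ∀ c, R (b 2) (b 1) x (b c) = -Λ 0 c := fun c => by rw [hR.antisymm_left, d12]
  have d02 : ∀ c, R (b 0) (b 2) x (b c) = -Λ 1 c := fun c => by rw [hR.antisymm_left, d20]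
  have d10 : ∀ c, R (b 1) (b 0) x (b c) = -Λ 2 c := fun c => by rw [hR.antisymm_left, d01]
  have hp : ∀ p q r : V, R x p q r = R q r x p := fun p q r => hR.pair_symm _ _ _ _
  -- This is the Bianchi identity for `x, b 0, b 1, b 2`.
  have htr : Λ 0 0 + Λ 1 1 + Λ 2 2 = 0 := by
    rw [← d12, ← d20, ← d01, ← hp, ← hp, ← hp]
    exact hR.bianchi x (b 0) (b 1) (b 2)
  have hE : ∀ p q r : Fin 3, nijForm R x A L ![b p, b q, b r] =
      1 / 2 * ∑ i, ℓ p i * ∑ j, κ i j *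
        (R (b r) (b q) x (b j) + R (b r) (b j) x (b q) -
          (R (b q) (b r) x (b j) + R (b q) (b j) x (b r))) +
      1 / 2 * ∑ i, ℓ p i * ((∑ j, κ q j * (R (b j) (b r) x (b i) + R (b j) (b i) x (b r))) -
        ∑ j, κ r j * (R (b j) (b q) x (b i) + R (b j) (b i) x (b q))) := by
    intro p q r
    change 1 / 2 * (R (b r) (b q) x (A (L (b p))) + R x (b q) (b r) (A (L (b p))) -
      (R (b q) (b r) x (A (L (b p))) + R x (b r) (b q) (A (L (b p))))) +
      1 / 2 * (R (A (b q)) (b r) x (L (b p)) + R x (b r) (A (b q)) (L (b p)) -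
      (R (A (b r)) (b q) x (L (b p)) + R x (b q) (A (b r)) (L (b p)))) = _
    simp only [hp, hL, hA, map_sum, map_smul, Submodule.coe_sum, Submodule.coe_smul,
      LinearMap.sum_apply, LinearMap.smul_apply, smul_eq_mul, mul_sub, mul_add,
      Finset.sum_sub_distrib, Finset.sum_add_distrib, Finset.mul_sum]
  simp only [hE]
  rw [sum_sign_perm_fin_three fun p q r => 1 / 2 * ∑ i, ℓ p i * ∑ j, κ i j *
        (R (b r) (b q) x (b j) + R (b r) (b j) x (b q) -
          (R (b q) (b r) x (b j) + R (b q) (b j) x (b r))) +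
      1 / 2 * ∑ i, ℓ p i * ((∑ j, κ q j * (R (b j) (b r) x (b i) + R (b j) (b i) x (b r))) -
        ∑ j, κ r j * (R (b j) (b q) x (b i) + R (b j) (b i) x (b q)))]
  simp only [Fin.sum_univ_three, d12, d20, d01, d21, d02, d10, hR.self_left, Matrix.trace_fin_three,
    Matrix.mul_apply, Matrix.transpose_apply]
  have h2 : Λ 2 2 = -Λ 0 0 - Λ 1 1 := by linarith
  rw [h2]
  ring

theorem cayley_hamilton_fin_three (κ : Matrix (Fin 3) (Fin 3) ℝ) :
    κ * κ * κ = κ.trace • (κ * κ) - (1 / 2 * (κ.trace ^ 2 - (κ * κ).trace)) • κ +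
      κ.det • (1 : Matrix (Fin 3) (Fin 3) ℝ) := by
  ext i j
  fin_cases i <;> fin_cases j <;>
    simp [Matrix.mul_apply, Fin.sum_univ_three, Matrix.trace_fin_three, Matrix.det_fin_three] <;>
    ring

end NijenhuisForm

/-! ### The quaternionic frame and the polynomial identities behind `det M` -/

section QuaternionFrame

/-- The components of `i y`, `j y`, `k y` for a quaternion `y`. -/
def quatMat (y : Fin 4 → ℝ) : Matrix (Fin 3) (Fin 4) ℝ :=
  !![-y 1, y 0, -y 3, y 2; -y 2, y 3, y 0, -y 1; -y 3, -y 2, y 1, y 0]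

/-- The components of `R(y, ·, y, ·)` for the diagonal tensor with entries `r`. -/
def curvMat (r : Fin 4 → Fin 4 → ℝ) (y : Fin 4 → ℝ) : Matrix (Fin 4) (Fin 4) ℝ :=
  Matrix.of fun i j => (if i = j then ∑ k, r i k * y k ^ 2 else 0) - r i j * y i * y j

/-- The components of `R(*(y ∧ ·), y ∧ ·)` for the diagonal tensor with entries `r`. -/
def starMat (r : Fin 4 → Fin 4 → ℝ) (y : Fin 4 → ℝ) : Matrix (Fin 4) (Fin 4) ℝ :=
  !![0, y 2 * y 3 * (r 2 1 - r 3 1), y 1 * y 3 * (r 3 2 - r 1 2), y 1 * y 2 * (r 1 3 - r 2 3);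
     y 2 * y 3 * (r 3 0 - r 2 0), 0, y 0 * y 3 * (r 0 2 - r 3 2), y 0 * y 2 * (r 2 3 - r 0 3);
     y 1 * y 3 * (r 1 0 - r 3 0), y 0 * y 3 * (r 3 1 - r 0 1), 0, y 0 * y 1 * (r 0 3 - r 1 3);
     y 1 * y 2 * (r 2 0 - r 1 0), y 0 * y 2 * (r 0 1 - r 2 1), y 0 * y 1 * (r 1 2 - r 0 2), 0]

theorem quatMat_mul_transpose (y : Fin 4 → ℝ) :
    quatMat y * (quatMat y).transpose = (∑ i, y i ^ 2) • (1 : Matrix (Fin 3) (Fin 3) ℝ) := by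
  ext i j
  fin_cases i <;> fin_cases j <;>
    simp [quatMat, Matrix.mul_apply, Fin.sum_univ_four] <;> ring

/-- Up to the factor `|y|²` this is the orthogonal projection onto `y^⊥`, which `iy, jy, ky` span.
-/
theorem transpose_mul_quatMat (y : Fin 4 → ℝ) :
    (quatMat y).transpose * quatMat y =
      (∑ i, y i ^ 2) • (1 : Matrix (Fin 4) (Fin 4) ℝ) - Matrix.vecMulVec y y := by
  ext i j
  fin_cases i <;> fin_cases j <;>
    simp [quatMat, Matrix.mul_apply, Fin.sum_univ_four, Fin.sum_univ_three, Matrix.vecMulVec_apply]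
      <;> ring

theorem quatMat_mulVec (y : Fin 4 → ℝ) : (quatMat y).mulVec y = 0 := by
  ext i
  fin_cases i <;> simp [quatMat, Matrix.mulVec, dotProduct, Fin.sum_univ_four] <;> ring

theorem curvMat_mulVec {r : Fin 4 → Fin 4 → ℝ} (y : Fin 4 → ℝ) : (curvMat r y).mulVec y = 0 := by
  ext i
  fin_cases i <;> simp [curvMat, Matrix.mulVec, dotProduct, Fin.sum_univ_four] <;> ring

theorem curvMat_transpose {r : Fin 4 → Fin 4 → ℝ} (hr : ∀ i j, r i j = r j i) (y : Fin 4 → ℝ) :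
    (curvMat r y).transpose = curvMat r y := by
  ext i j
  by_cases h : i = j
  · rw [h]; rfl
  · simp [curvMat, h, Ne.symm h, hr j i]; ring

theorem trace_curvMat_mul_starMat (w t : Fin 3 → ℝ) (s : ℝ) (y : Fin 4 → ℝ) :
    (curvMat (paramCoeff w t s) y * starMat (paramCoeff w t s) y).trace = 0 := by
  simp [Matrix.trace, Matrix.mul_apply, Fin.sum_univ_four, curvMat, starMat, paramCoeff]
  ring

/-- This is where the determinant of `M` enters: after `w₂` is eliminated, the trace of degree eight
in `y` factors completely. -/
theorem trace_curvMat_sq_mul_starMat {w t : Fin 3 → ℝ} (hw : w 0 + w 1 + w 2 = 0) (s : ℝ)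
    (y : Fin 4 → ℝ) :
    (curvMat (paramCoeff w t s) y * curvMat (paramCoeff w t s) y *
        starMat (paramCoeff w t s) y).trace =
      2 * (ksMatrix w t).det * (y 0 * y 1 * y 2 * y 3) * ∑ i, y i ^ 2 := by
  have h2 : w 2 = -w 0 - w 1 := by linarith
  simp [Matrix.trace, Matrix.mul_apply, Fin.sum_univ_four, curvMat, starMat, paramCoeff,
    Matrix.det_fin_three, ksMatrix]
  rw [h2]
  ring

end QuaternionFrame

/-! ### Integrability in the diagonal case -/

section Integrability

variable {V : Type*} [NormedAddCommGroup V] [InnerProductSpace ℝ V]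

/-- The vectors `i y`, `j y`, `k y` in `V`. -/
noncomputable def quatVec (e : OrthonormalBasis (Fin 4) ℝ V) (y : V) (a : Fin 3) : V :=
  e.repr.symm (WithLp.toLp 2 (quatMat (e.repr y) a))

theorem repr_quatVec (e : OrthonormalBasis (Fin 4) ℝ V) (y : V) (a : Fin 3) (i : Fin 4) :
    e.repr (quatVec e y a) i = quatMat (e.repr y) a i := by
  simp [quatVec]

theorem inner_eq_sum_repr (e : OrthonormalBasis (Fin 4) ℝ V) (v w : V) :
    inner ℝ v w = ∑ i, e.repr v i * e.repr w i := by
  rw [← e.repr.inner_map_map, PiLp.inner_apply]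
  exact Finset.sum_congr rfl fun i _ => mul_comm _ _

theorem sum_repr_sq (e : OrthonormalBasis (Fin 4) ℝ V) (x : Metric.sphere (0 : V) 1) :
    ∑ i, e.repr (x : V) i ^ 2 = 1 := by
  have h := real_inner_self_eq_norm_sq (x : V)
  rw [norm_coe_sphere, inner_eq_sum_repr e] at h
  simpa [sq] using h

theorem quatVec_mem (e : OrthonormalBasis (Fin 4) ℝ V) (y : V) (a : Fin 3) :
    quatVec e y a ∈ Tan y := by
  rw [Submodule.mem_orthogonal_singleton_iff_inner_left, inner_eq_sum_repr e]
  simpa [repr_quatVec, Matrix.mulVec, dotProduct] using congrFun (quatMat_mulVec (e.repr y)) a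

theorem exists_quatFrame (e : OrthonormalBasis (Fin 4) ℝ V) (x : Metric.sphere (0 : V) 1) :
    ∃ b : OrthonormalBasis (Fin 3) ℝ (Tan (x : V)), ∀ a, (b a : V) = quatVec e x a := by
  let b : Fin 3 → Tan (x : V) := fun a => ⟨quatVec e x a, quatVec_mem e x a⟩
  have hb : Orthonormal ℝ b := by
    rw [orthonormal_iff_ite]
    intro i j
    rw [Submodule.coe_inner, inner_eq_sum_repr e]
    have h := congrFun (congrFun (quatMat_mul_transpose (e.repr (x : V))) i) j
    rw [sum_repr_sq, one_smul, Matrix.one_apply] at h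
    rw [← h]
    simp [b, repr_quatVec, Matrix.mul_apply]
  have hx : (x : V) ≠ 0 := by
    intro h
    simpa [h] using norm_coe_sphere x
  have : Fact (Module.finrank ℝ V = 3 + 1) := ⟨by
    rw [Module.finrank_eq_card_basis e.toBasis, Fintype.card_fin]⟩
  have hc : Fintype.card (Fin 3) = Module.finrank ℝ (Tan (x : V)) := by
    rw [Submodule.finrank_orthogonal_span_singleton (n := 3) hx, Fintype.card_fin]
  have hB : ⇑(basisOfOrthonormalOfCardEqFinrank hb hc) = b :=
    coe_basisOfOrthonormalOfCardEqFinrank hb hc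
  refine ⟨(basisOfOrthonormalOfCardEqFinrank hb hc).toOrthonormalBasis (by rwa [hB]), fun a => ?_⟩
  rw [Module.Basis.coe_toOrthonormalBasis, hB]

theorem diagTensor_quatVec_curv (e : OrthonormalBasis (Fin 4) ℝ V) {r : Fin 4 → Fin 4 → ℝ}
    (hr : ∀ i j, r i j = r j i) (x : V) (a c : Fin 3) :
    diagTensor e r x (quatVec e x a) x (quatVec e x c) =
      (quatMat (e.repr x) * curvMat r (e.repr x) * (quatMat (e.repr x)).transpose) a c := by
  simp only [diagTensor_apply, repr_quatVec, Matrix.mul_apply, Matrix.transpose_apply, curvMat,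
    Matrix.of_apply]
  generalize quatMat (e.repr x) = B
  simp only [Fin.sum_univ_four, hr 1 0, hr 2 0, hr 3 0, hr 2 1, hr 3 1, hr 3 2]
  simp
  ring

theorem diagTensor_quatVec_star (e : OrthonormalBasis (Fin 4) ℝ V) {r : Fin 4 → Fin 4 → ℝ}
    (hr : ∀ i j, r i j = r j i) (x : V) (a c : Fin 3) :
    diagTensor e r (quatVec e x (a + 1)) (quatVec e x (a + 2)) x (quatVec e x c) =
      (quatMat (e.repr x) * starMat r (e.repr x) * (quatMat (e.repr x)).transpose) a c := by
  simp only [diagTensor_apply, repr_quatVec, Matrix.mul_apply, Matrix.transpose_apply]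
  generalize hz : quatMat (e.repr x) c = z
  simp only [Fin.sum_univ_four, hr 1 0, hr 2 0, hr 3 0, hr 2 1, hr 3 1, hr 3 2]
  fin_cases a <;> simp [quatMat, starMat] <;>
    simp only [hr 1 0, hr 2 0, hr 3 0, hr 2 1, hr 3 1, hr 3 2] <;> ring

/-- On the unit sphere the inner product `BᵀB` of the frame matrices is `1 - yyᵀ`, and `curvMat r y`
annihilates `y`. Matrix products in the frame can therefore be computed in the four ambient
coordinates. -/
theorem frame_mul_frame (r : Fin 4 → Fin 4 → ℝ) {y : Fin 4 → ℝ} (hy : ∑ i, y i ^ 2 = 1)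
    (N : Matrix (Fin 4) (Fin 4) ℝ) :
    quatMat y * curvMat r y * (quatMat y).transpose * (quatMat y * N * (quatMat y).transpose) =
      quatMat y * (curvMat r y * N) * (quatMat y).transpose := by
  have hB := transpose_mul_quatMat y
  rw [hy, one_smul] at hB
  have hC : curvMat r y * ((quatMat y).transpose * quatMat y) = curvMat r y := by
    rw [hB, mul_sub, mul_one, Matrix.mul_vecMulVec, curvMat_mulVec]
    simp
  calc _ = quatMat y * (curvMat r y * ((quatMat y).transpose * quatMat y) * N *
        (quatMat y).transpose) := by simp only [Matrix.mul_assoc]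
    _ = _ := by rw [hC]; simp only [Matrix.mul_assoc]

theorem trace_frame_mul {r : Fin 4 → Fin 4 → ℝ} (hr : ∀ i j, r i j = r j i) {y : Fin 4 → ℝ}
    (hy : ∑ i, y i ^ 2 = 1) (N : Matrix (Fin 4) (Fin 4) ℝ) :
    (quatMat y * curvMat r y * (quatMat y).transpose *
      (quatMat y * N * (quatMat y).transpose)).trace = (curvMat r y * N).trace := by
  have hB := transpose_mul_quatMat y
  rw [hy, one_smul] at hB
  have hC : (quatMat y).transpose * quatMat y * curvMat r y = curvMat r y := by
    have hv : Matrix.vecMul y (curvMat r y) = 0 := by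
      rw [← Matrix.mulVec_transpose, curvMat_transpose hr, curvMat_mulVec]
    rw [hB, sub_mul, one_mul, Matrix.vecMulVec_mul, hv]
    simp
  rw [frame_mul_frame r hy, Matrix.trace_mul_comm, ← Matrix.mul_assoc, ← Matrix.mul_assoc, hC]

theorem sum_sign_inner_nijenhuis (e : OrthonormalBasis (Fin 4) ℝ V) {R : FourTensor V}
    {K : EndoField V} (hR : IsAlgCurv R) (hK : IsCurvatureOf R K) (x : Metric.sphere (0 : V) 1)
    (L : Tan (x : V) →ₗ[ℝ] Tan (x : V)) (v : Fin 3 → Tan (x : V)) :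
    ∑ σ : Equiv.Perm (Fin 3), ((Equiv.Perm.sign σ : ℤ) : ℝ) *
      inner ℝ (L (v (σ 0))) (nijenhuis K x (v (σ 1)) (v (σ 2))) =
    ∑ σ : Equiv.Perm (Fin 3), ((Equiv.Perm.sign σ : ℤ) : ℝ) *
      nijForm R x (K x) L ![v (σ 0), v (σ 1), v (σ 2)] := by
  refine Finset.sum_congr rfl fun σ _ => ?_
  rw [inner_nijenhuis e hR hK]
  rfl

/-- The three contractions of the Nijenhuis torsion of a diagonal Killing tensor, evaluated on a
suitable orthonormal frame. -/
theorem exists_frame_contractions {e : OrthonormalBasis (Fin 4) ℝ V} {R : FourTensor V}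
    {K : EndoField V} {w t : Fin 3 → ℝ} {s : ℝ} (hR : IsAlgCurv R) (hK : IsCurvatureOf R K)
    (hd : IsDiagonal e R) (hp : HasParams e R w t s) (x : Metric.sphere (0 : V) 1) :
    ∃ (b : Module.Basis (Fin 3) ℝ (Tan (x : V))) (c : ℝ),
      (∑ σ : Equiv.Perm (Fin 3), ((Equiv.Perm.sign σ : ℤ) : ℝ) *
        nijForm R x (K x) LinearMap.id ![b (σ 0), b (σ 1), b (σ 2)] = 0) ∧
      (∑ σ : Equiv.Perm (Fin 3), ((Equiv.Perm.sign σ : ℤ) : ℝ) *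
        nijForm R x (K x) (K x) ![b (σ 0), b (σ 1), b (σ 2)] =
          -12 * (ksMatrix w t).det * ∏ i, e.repr (x : V) i) ∧
      (∑ σ : Equiv.Perm (Fin 3), ((Equiv.Perm.sign σ : ℤ) : ℝ) *
        nijForm R x (K x) (K x ∘ₗ K x) ![b (σ 0), b (σ 1), b (σ 2)] = c * (ksMatrix w t).det) := by
  obtain ⟨b, hb⟩ := exists_quatFrame e x
  have hr := paramCoeff_symm w t s
  have hy := sum_repr_sq e x
  have hRd := hp.eq_diagTensor hR hd
  set y : Fin 4 → ℝ := (e.repr (x : V)).ofLp with hyd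
  set r := paramCoeff w t s with hrd
  set κ := quatMat y * curvMat r y * (quatMat y).transpose with hκ
  set Λ := quatMat y * starMat r y * (quatMat y).transpose with hΛd
  have hA : ∀ a, K x (b a) = ∑ c, κ a c • b c := by
    intro a
    conv_lhs => rw [← b.sum_repr' (K x (b a))]
    refine Finset.sum_congr rfl fun c _ => ?_
    rw [real_inner_comm, hK, hb, hb, hRd, diagTensor_quatVec_curv e hr]
  have hΛ : ∀ a c, R (b (a + 1)) (b (a + 2)) x (b c) = Λ a c := by
    intro a c
    rw [hb, hb, hb, hRd, diagTensor_quatVec_star e hr]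
  have hA1 : ∀ a, (LinearMap.id : Tan (x : V) →ₗ[ℝ] Tan (x : V)) (b a) =
      ∑ c, (1 : Matrix (Fin 3) (Fin 3) ℝ) a c • b c := by
    intro a
    simp [Matrix.one_apply]
  have hA2 : ∀ a, (K x ∘ₗ K x) (b a) = ∑ c, (κ * κ) a c • b c := by
    intro a
    simp only [LinearMap.comp_apply, hA, map_sum, map_smul, Matrix.mul_apply, Finset.sum_smul,
      Finset.smul_sum, smul_smul]
    rw [Finset.sum_comm]
  have hκt : κ.transpose = κ := by
    simp [hκ, Matrix.transpose_mul, curvMat_transpose hr, Matrix.mul_assoc]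
  have h1 : (κ * Λ.transpose).trace = 0 := by
    rw [← Matrix.trace_transpose, Matrix.transpose_mul, Matrix.transpose_transpose, hκt,
      Matrix.trace_mul_comm, hκ, hΛd, trace_frame_mul hr hy]
    exact trace_curvMat_mul_starMat w t s y
  -- Transposition replaces `Λᵀ` by `Λ`, since `κ` is symmetric; the trace then moves to the ambient
  -- coordinates.
  have h2 : (κ * κ * Λ.transpose).trace = 2 * (ksMatrix w t).det * ∏ i, y i := by
    have h := trace_curvMat_sq_mul_starMat (t := t) hp.sum_zero s y
    rw [hy, mul_one] at h
    rw [← Matrix.trace_transpose, Matrix.transpose_mul, Matrix.transpose_transpose,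
      Matrix.transpose_mul, hκt, Matrix.trace_mul_comm, Matrix.mul_assoc, Fin.prod_univ_four, ← h]
    have h3 : κ * Λ = quatMat y * (curvMat r y * starMat r y) * (quatMat y).transpose :=
      frame_mul_frame r hy _
    rw [h3, hκ, trace_frame_mul hr hy, Matrix.mul_assoc]
  -- Cayley-Hamilton; its term linear in `κ` drops out by `h1`.
  have h3 : (κ * κ * κ * Λ.transpose).trace = κ.trace * (κ * κ * Λ.transpose).trace +
      κ.det * Λ.transpose.trace := by
    rw [cayley_hamilton_fin_three, add_mul, sub_mul, Matrix.smul_mul, Matrix.smul_mul,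
      Matrix.smul_mul, one_mul, Matrix.trace_add, Matrix.trace_sub, Matrix.trace_smul,
      Matrix.trace_smul, Matrix.trace_smul, h1]
    simp
  have h4 : Λ.transpose.trace = 0 := by
    rw [Matrix.trace_transpose, Matrix.trace_fin_three, ← hΛ, ← hΛ, ← hΛ,
      ← hR.pair_symm _ _ _ _, ← hR.pair_symm (b (1 + 1)) _ _ _, ← hR.pair_symm (b (2 + 1)) _ _ _]
    exact hR.bianchi x (b 0) (b 1) (b 2)
  -- With `L = K²` the contraction is `-6 tr(κ³Λᵀ) + 2 tr κ tr(κ²Λᵀ) = -4 tr κ tr(κ²Λᵀ)`, and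
  -- `tr(κ²Λᵀ) = 2 det M ∏ yᵢ`.
  refine ⟨b.toBasis, -8 * κ.trace * ∏ i, y i, ?_, ?_, ?_⟩ <;>
    simp only [OrthonormalBasis.coe_toBasis]
  · rw [sum_sign_nijForm_frame hR hA hA1 hΛ]
    simp [h1, h4]
  · rw [sum_sign_nijForm_frame hR hA hA hΛ, h1, h2]
    ring
  · rw [sum_sign_nijForm_frame hR hA hA2 hΛ, ← Matrix.mul_assoc κ κ κ, h3, h1, h2, h4]
    ring

/-- The three contractions are zero or multiples of `det M`, which gives sufficiency. For necessity,
the second contraction is evaluated at one point with all coordinates nonzero. -/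
theorem isIntegrable_iff {e : OrthonormalBasis (Fin 4) ℝ V} {R : FourTensor V}
    {K : EndoField V} {w t : Fin 3 → ℝ} {s : ℝ} (hR : IsAlgCurv R) (hK : IsCurvatureOf R K)
    (hd : IsDiagonal e R) (hp : HasParams e R w t s) :
    IsIntegrable K ↔ (ksMatrix w t).det = 0 := by
  constructor
  · intro h
    -- The point with coordinates `(1/2, 1/2, 1/2, 1/2)` lies on the sphere and off all coordinate
    -- hyperplanes.
    have hx : ‖e.repr.symm (WithLp.toLp 2 fun _ : Fin 4 => (1 / 2 : ℝ))‖ = 1 := by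
      rw [LinearIsometryEquiv.norm_map, EuclideanSpace.norm_eq]
      norm_num
    let x : Metric.sphere (0 : V) 1 := ⟨_, mem_sphere_zero_iff_norm.2 hx⟩
    obtain ⟨b, c, -, h2, -⟩ := exists_frame_contractions hR hK hd hp x
    have h1 := h.cond_killing x b
    rw [sum_sign_inner_nijenhuis e hR hK, h2, Fin.prod_univ_four] at h1
    have hxi : ∀ i, e.repr (x : V) i = 1 / 2 := fun i => by simp [x]
    rw [hxi, hxi, hxi, hxi] at h1
    linarith
  · intro h
    refine ⟨fun x v => ?_, fun x v => ?_, fun x v => ?_⟩ <;>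
      obtain ⟨b, c, h1, h2, h3⟩ := exists_frame_contractions hR hK hd hp x
    · rw [← sum_sign_multilinear_eq_zero b _ h1 v]
      exact sum_sign_inner_nijenhuis e hR hK x LinearMap.id v
    · rw [h, mul_zero, zero_mul] at h2
      rw [← sum_sign_multilinear_eq_zero b _ h2 v]
      exact sum_sign_inner_nijenhuis e hR hK x (K x) v
    · rw [h, mul_zero] at h3
      rw [← sum_sign_multilinear_eq_zero b _ h3 v, ← sum_sign_inner_nijenhuis e hR hK]
      -- By symmetry of `K`, `⟨K u, K N⟩` is the contraction with `L = K ∘ K`.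
      simp only [LinearMap.comp_apply, (isKillingTensor e hR hK).symm]

end Integrability

/-! ### The Killing-Stäckel variety as a cubic -/

section Variety

/-- The determinant is homogeneous, so its vanishing does not depend on the representative chosen in
`ksVariety`. -/
theorem mk_mem_ksVariety_iff (M : ksSpace) (h : M ≠ 0) :
    Projectivization.mk ℝ M h ∈ ksVariety ↔ (M : Matrix (Fin 3) (Fin 3) ℝ).det = 0 := by
  obtain ⟨a, ha⟩ := Projectivization.exists_smul_eq_mk_rep ℝ M h
  have h1 : ((Projectivization.mk ℝ M h).rep : Matrix (Fin 3) (Fin 3) ℝ) =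
      (a : ℝ) • (M : Matrix (Fin 3) (Fin 3) ℝ) := by
    rw [← ha]; rfl
  change Matrix.det _ = 0 ↔ _
  rw [h1, Matrix.det_smul]
  simp

theorem ksElem_smul (c : ℝ) (w t : Fin 3 → ℝ) :
    ksElem (fun α => c * w α) (fun α => c * t α) = c • ksElem w t := by
  refine Subtype.ext ?_
  rw [Submodule.coe_smul]
  change ksMatrix (fun α => c * w α) (fun α => c * t α) = c • ksMatrix w t
  ext i j
  fin_cases i <;> fin_cases j <;> simp [ksMatrix, mul_sub]

theorem exists_ksElem_eq (M : ksSpace) :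
    ∃ w t : Fin 3 → ℝ, w 0 + w 1 + w 2 = 0 ∧ ksElem w t = M := by
  obtain ⟨M, h1, h2⟩ := M
  rw [Matrix.trace_fin_three] at h2
  -- As `w₁ + w₂ + w₃ = 0`, one has `Δ₃ - Δ₂ = 3w₁`, and cyclically.
  refine ⟨![(M 2 2 - M 1 1) / 3, (M 0 0 - M 2 2) / 3, (M 1 1 - M 0 0) / 3],
    ![M 2 1, M 0 2, M 1 0], ?_, Subtype.ext ?_⟩
  · simp; ring
  · change ksMatrix _ _ = M
    have h01 := h1 0 1 (by decide)
    have h02 := h1 0 2 (by decide)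
    have h12 := h1 1 2 (by decide)
    ext i j
    fin_cases i <;> fin_cases j <;> simp [ksMatrix] <;> linarith

theorem ksMatrix_trace (w t : Fin 3 → ℝ) : (ksMatrix w t).trace = 0 := (ksMatrix_mem w t).2

theorem ksVariety_eq {V : Type*} [NormedAddCommGroup V] [InnerProductSpace ℝ V]
    (e : OrthonormalBasis (Fin 4) ℝ V) :
    ksVariety = {p | ∃ (K : EndoField V) (R : FourTensor V) (w t : Fin 3 → ℝ) (s : ℝ),
      IsKillingTensor K ∧ IsAlgCurv R ∧ IsCurvatureOf R K ∧
      IsDiagonal e R ∧ HasParams e R w t s ∧ IsIntegrable K ∧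
      ∃ h : ksElem w t ≠ 0, p = Projectivization.mk ℝ (ksElem w t) h} := by
  ext p
  constructor
  · intro hp
    obtain ⟨w, t, hw, hM⟩ := exists_ksElem_eq p.rep
    have hR := isAlgCurv_diagTensor e (paramCoeff_symm w t 0)
    have hd := isDiagonal_diagTensor e (paramCoeff w t 0)
    have hq := hasParams_diagTensor e hw t 0
    have hK := isCurvatureOf_curvField e hR
    have h : ksElem w t ≠ 0 := hM ▸ p.rep_nonzero
    refine ⟨curvField e hR, _, w, t, 0, isKillingTensor e hR hK, hR, hK, hd, hq,
      (isIntegrable_iff hR hK hd hq).2 ?_, h, ?_⟩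
    · have h1 : (p.rep : Matrix (Fin 3) (Fin 3) ℝ).det = 0 := hp
      rwa [← hM] at h1
    · simp only [hM, Projectivization.mk_rep]
  · rintro ⟨K, R, w, t, s, -, hR, hK, hd, hq, hI, h, rfl⟩
    exact (mk_mem_ksVariety_iff _ h).2 ((isIntegrable_iff hR hK hd hq).1 hI)

/-- Coordinates on the space of matrices with diagonal trace free symmetric part. -/
def ksCoord : ksSpace ≃ₗ[ℝ] (Fin 5 → ℝ) where
  toFun M := ![M.1 0 0, M.1 1 1, M.1 2 1, M.1 0 2, M.1 1 0]
  map_add' M N := by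
    ext i
    fin_cases i <;> rfl
  map_smul' c M := by
    ext i
    fin_cases i <;> rfl
  invFun v := ⟨!![v 0, -v 4, v 3; v 4, v 1, -v 2; -v 3, v 2, -v 0 - v 1], by
    refine ⟨fun i j hij => ?_, ?_⟩
    · fin_cases i <;> fin_cases j <;> simp at hij ⊢
    · simp [Matrix.trace_fin_three]⟩
  left_inv M := by
    obtain ⟨M, h1, h2⟩ := M
    rw [Matrix.trace_fin_three] at h2
    have h01 := h1 0 1 (by decide)
    have h02 := h1 0 2 (by decide)
    have h12 := h1 1 2 (by decide)
    refine Subtype.ext ?_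
    ext i j
    fin_cases i <;> fin_cases j <;> simp <;> linarith
  right_inv v := by
    ext i
    fin_cases i <;> rfl

/-- The determinant as a cubic form in the coordinates `ksCoord`. -/
noncomputable def ksCubic : MvPolynomial (Fin 5) ℝ :=
  MvPolynomial.X 0 * MvPolynomial.X 1 * (-MvPolynomial.X 0 - MvPolynomial.X 1) +
    MvPolynomial.X 0 * MvPolynomial.X 2 * MvPolynomial.X 2 +
    MvPolynomial.X 1 * MvPolynomial.X 3 * MvPolynomial.X 3 +
    (-MvPolynomial.X 0 - MvPolynomial.X 1) * MvPolynomial.X 4 * MvPolynomial.X 4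

theorem eval_ksCubic (M : ksSpace) :
    MvPolynomial.eval (ksCoord M) ksCubic = (M : Matrix (Fin 3) (Fin 3) ℝ).det := by
  obtain ⟨v, rfl⟩ := ksCoord.symm.surjective M
  rw [LinearEquiv.apply_symm_apply]
  change _ = Matrix.det !![v 0, -v 4, v 3; v 4, v 1, -v 2; -v 3, v 2, -v 0 - v 1]
  rw [Matrix.det_fin_three]
  simp [ksCubic]
  ring

theorem ksCubic_ne_zero : ksCubic ≠ 0 := by
  intro h
  have h1 := congrArg (MvPolynomial.eval ![1, 0, 1, 0, 0]) h
  simp [ksCubic] at h1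

theorem isHomogeneous_ksCubic : ksCubic.IsHomogeneous 3 := by
  have hX := fun i : Fin 5 => MvPolynomial.isHomogeneous_X ℝ i
  have hs : (-MvPolynomial.X 0 - MvPolynomial.X 1 : MvPolynomial (Fin 5) ℝ).IsHomogeneous 1 :=
    (hX 0).neg.sub (hX 1)
  exact ((((hX 0).mul (hX 1)).mul hs).add (((hX 0).mul (hX 2)).mul (hX 2)) |>.add
    (((hX 1).mul (hX 3)).mul (hX 3))).add ((hs.mul (hX 4)).mul (hX 4))

theorem exists_cubic : ∃ (b : Module.Basis (Fin 5) ℝ ksSpace) (f : MvPolynomial (Fin 5) ℝ),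
    f ≠ 0 ∧ f.IsHomogeneous 3 ∧ ∀ (M : ksSpace) (h : M ≠ 0),
      Projectivization.mk ℝ M h ∈ ksVariety ↔ MvPolynomial.eval (b.repr M) f = 0 := by
  refine ⟨Module.Basis.ofEquivFun ksCoord, ksCubic, ksCubic_ne_zero, isHomogeneous_ksCubic,
    fun M h => ?_⟩
  rw [mk_mem_ksVariety_iff, ← eval_ksCubic]
  have h1 : ⇑((Module.Basis.ofEquivFun ksCoord).repr M) = ksCoord M := by
    ext i
    simp
  rw [h1]

end Variety

/-! ### Permutations of the vertices of a tetrahedron -/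

section Tetrahedron

/-- The vertices of a regular tetrahedron inscribed in the cube. -/
def tet : Fin 4 → Fin 3 → ℤ := ![![1, 1, 1], ![1, -1, -1], ![-1, 1, -1], ![-1, -1, 1]]

/-- The isometry of the tetrahedron which permutes its vertices by `σ`. -/
def tetMat (σ : Equiv.Perm (Fin 4)) : Matrix (Fin 3) (Fin 3) ℤ :=
  Matrix.of fun α β => (∑ i, tet (σ i) α * tet i β) / 4

/-- A signed permutation matrix. -/
def signedPermMat (π : Equiv.Perm (Fin 3)) (ε : Fin 3 → ℤˣ) : Matrix (Fin 3) (Fin 3) ℤ :=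
  Matrix.of fun α β => if α = π β then (ε β : ℤ) else 0

/-- The permutation `σ` of the vertices of the tetrahedron acts on the coordinates of `ℝ³` by the
permutation `π` with the signs `ε`. -/
def IsSignedPermOf (σ : Equiv.Perm (Fin 4)) (π : Equiv.Perm (Fin 3)) (ε : Fin 3 → ℤˣ) : Prop :=
  ε 0 * ε 1 * ε 2 = 1 ∧ Equiv.Perm.sign π = Equiv.Perm.sign σ ∧
    tetMat σ = signedPermMat π ε ∧
    ∀ i β, tet (σ i) (π β) = ε β * tet i β

instance (σ : Equiv.Perm (Fin 4)) (π : Equiv.Perm (Fin 3)) (ε : Fin 3 → ℤˣ) :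
    Decidable (IsSignedPermOf σ π ε) := by
  unfold IsSignedPermOf
  infer_instance

/-- The isometries of the tetrahedron are the 24 signed permutations of the coordinates with product
of signs `1`. This lemma and the next one give the two directions of that correspondence. -/
theorem exists_isSignedPermOf_perm :
    ∀ σ : Equiv.Perm (Fin 4),
      ∃ (π : Equiv.Perm (Fin 3)) (ε : Fin 3 → ℤˣ), IsSignedPermOf σ π ε := by
  decide +kernel

theorem exists_isSignedPermOf_signs :
    ∀ (π : Equiv.Perm (Fin 3)) (ε : Fin 3 → ℤˣ), ε 0 * ε 1 * ε 2 = 1 →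
      ∃ σ : Equiv.Perm (Fin 4), IsSignedPermOf σ π ε := by
  decide +kernel

theorem sum_tetMat_mul_tet : ∀ (σ : Equiv.Perm (Fin 4)) (i : Fin 4) (α : Fin 3),
    ∑ γ, tetMat σ α γ * tet i γ = tet (σ i) α := by
  decide +kernel

/-- The integer division in `tetMat` is exact. The factor 4 arises because the outer squares of the
vertices add up to four times the identity. -/
theorem four_mul_tetMat : ∀ (σ : Equiv.Perm (Fin 4)) (α β : Fin 3),
    4 * tetMat σ α β = ∑ i, tet (σ i) α * tet i β := by
  decide +kernel

theorem tetMat_mul_transpose : ∀ σ : Equiv.Perm (Fin 4),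
    tetMat σ * (tetMat σ).transpose = 1 := by
  decide +kernel

/-- A transposition of two vertices is a reflection. -/
theorem det_tetMat (σ : Equiv.Perm (Fin 4)) : (tetMat σ).det = Equiv.Perm.sign σ := by
  rw [Matrix.det_fin_three]
  revert σ
  decide +kernel

theorem eq_one_of_sign_smul_tetMat : ∀ σ : Equiv.Perm (Fin 4),
    (Equiv.Perm.sign σ : ℤ) • tetMat σ = 1 → σ = 1 := by
  decide +kernel

/-- Multiplying a signed permutation matrix of determinant one by the sign of its permutation makes
the product of its signs `1`, so it becomes an isometry of the tetrahedron. -/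
theorem exists_sign_smul_tetMat : ∀ (π : Equiv.Perm (Fin 3)) (δ : Fin 3 → ℤˣ),
    Equiv.Perm.sign π * (δ 0 * δ 1 * δ 2) = 1 →
      ∃ σ : Equiv.Perm (Fin 4), (Equiv.Perm.sign σ : ℤ) • tetMat σ = signedPermMat π δ := by
  decide +kernel

theorem det_signedPermMat (π : Equiv.Perm (Fin 3)) (δ : Fin 3 → ℤˣ) :
    (signedPermMat π δ).det = (Equiv.Perm.sign π * (δ 0 * δ 1 * δ 2) : ℤˣ) := by
  rw [Matrix.det_fin_three]
  revert π δ
  decide +kernel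

theorem tetMat_mul (σ τ : Equiv.Perm (Fin 4)) : tetMat (σ * τ) = tetMat σ * tetMat τ := by
  ext α β
  refine mul_left_cancel₀ (four_ne_zero (α := ℤ)) ?_
  rw [four_mul_tetMat, Matrix.mul_apply, Finset.mul_sum]
  calc ∑ i, tet ((σ * τ) i) α * tet i β = ∑ i, (∑ γ, tetMat σ α γ * tet (τ i) γ) * tet i β := by
        simp only [sum_tetMat_mul_tet, Equiv.Perm.mul_apply]
    _ = ∑ γ, tetMat σ α γ * ∑ i, tet (τ i) γ * tet i β := by
        simp only [Finset.sum_mul, Finset.mul_sum, mul_assoc]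
        rw [Finset.sum_comm]
    _ = _ := by
        refine Finset.sum_congr rfl fun γ _ => ?_
        rw [← four_mul_tetMat]
        ring

end Tetrahedron

/-! ### The rotation group of the octahedron and its action on matrices -/

section OctahedralGroup

/-- The rotation of the octahedron attached to a permutation of the diagonals of the cube. -/
noncomputable def rotMat (σ : Equiv.Perm (Fin 4)) : Matrix (Fin 3) (Fin 3) ℝ :=
  (Int.castRingHom ℝ).mapMatrix ((Equiv.Perm.sign σ : ℤ) • tetMat σ)

theorem rotMat_mul (σ τ : Equiv.Perm (Fin 4)) : rotMat (σ * τ) = rotMat σ * rotMat τ := by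
  rw [rotMat, rotMat, rotMat, ← map_mul, tetMat_mul, Equiv.Perm.sign_mul, Matrix.smul_mul,
    Matrix.mul_smul, smul_smul, Units.val_mul]

theorem sign_mul_self (σ : Equiv.Perm (Fin 4)) :
    (Equiv.Perm.sign σ : ℤ) * (Equiv.Perm.sign σ : ℤ) = 1 := by
  rw [← Units.val_mul, Int.units_mul_self, Units.val_one]

theorem rotMat_one : rotMat 1 = 1 := by
  have h : tetMat 1 = 1 := by decide +kernel
  simp [rotMat, h]

theorem rotMat_mem (σ : Equiv.Perm (Fin 4)) :
    rotMat σ ∈ Matrix.specialOrthogonalGroup (Fin 3) ℝ := by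
  rw [Matrix.mem_specialOrthogonalGroup_iff, Matrix.mem_orthogonalGroup_iff]
  constructor
  · have h : (rotMat σ).transpose = (Int.castRingHom ℝ).mapMatrix
        (((Equiv.Perm.sign σ : ℤ) • tetMat σ).transpose) := rfl
    rw [h, rotMat, ← map_mul, Matrix.transpose_smul, Matrix.smul_mul, Matrix.mul_smul, smul_smul,
      sign_mul_self, one_smul, tetMat_mul_transpose, map_one]
  · rw [rotMat, ← RingHom.map_det, Matrix.det_smul, det_tetMat, Fintype.card_fin, ← pow_succ]
    have h : (Equiv.Perm.sign σ : ℤ) ^ (3 + 1) =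
        ((Equiv.Perm.sign σ : ℤ) * (Equiv.Perm.sign σ : ℤ)) ^ 2 := by ring
    rw [h, sign_mul_self]
    simp

theorem rotMat_apply {σ : Equiv.Perm (Fin 4)} {π : Equiv.Perm (Fin 3)} {ε : Fin 3 → ℤˣ}
    (h : IsSignedPermOf σ π ε) (α β : Fin 3) :
    rotMat σ α β = if α = π β then ((Equiv.Perm.sign σ : ℤ) : ℝ) * ((ε β : ℤ) : ℝ) else 0 := by
  rw [rotMat, h.2.2.1]
  simp [signedPermMat]

theorem units_cast (u : ℤˣ) : ((u : ℤ) : ℝ) = 1 ∨ ((u : ℤ) : ℝ) = -1 := by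
  rcases Int.units_eq_one_or u with rfl | rfl <;> simp

theorem rotMat_mulVec_octahedron_subset (σ : Equiv.Perm (Fin 4)) :
    (fun v => (rotMat σ).mulVec v) '' octahedron ⊆ octahedron := by
  obtain ⟨π, ε, h⟩ := exists_isSignedPermOf_perm σ
  have hk : ∀ k, (rotMat σ).mulVec (Pi.single k 1) =
      (((Equiv.Perm.sign σ : ℤ) : ℝ) * ((ε k : ℤ) : ℝ)) • Pi.single (π k) 1 := by
    intro k
    ext α
    rw [Matrix.mulVec_single_one, Matrix.col_apply, rotMat_apply h]
    simp [Pi.single_apply]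
  have hs : ∀ k, ((Equiv.Perm.sign σ : ℤ) : ℝ) * ((ε k : ℤ) : ℝ) = 1 ∨
      ((Equiv.Perm.sign σ : ℤ) : ℝ) * ((ε k : ℤ) : ℝ) = -1 := by
    intro k
    rw [← Int.cast_mul, ← Units.val_mul]
    exact units_cast _
  rintro _ ⟨_, ⟨k, rfl | rfl⟩, rfl⟩
  · refine ⟨π k, ?_⟩
    simp only [hk]
    rcases hs k with h | h <;> simp [h]
  · refine ⟨π k, ?_⟩
    simp only [Matrix.mulVec_neg, hk]
    rcases hs k with h | h <;> simp [h]

theorem rotMat_mulVec_octahedron (σ : Equiv.Perm (Fin 4)) :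
    (fun v => (rotMat σ).mulVec v) '' octahedron = octahedron := by
  refine (rotMat_mulVec_octahedron_subset σ).antisymm fun v hv => ?_
  refine ⟨(rotMat σ⁻¹).mulVec v, rotMat_mulVec_octahedron_subset σ⁻¹ ⟨v, hv, rfl⟩, ?_⟩
  simp [Matrix.mulVec_mulVec, ← rotMat_mul, rotMat_one]

/-- The homomorphism from `S₄` to the group of rotations of the octahedron. -/
noncomputable def octHom : Equiv.Perm (Fin 4) →* octGroup where
  toFun σ := ⟨⟨rotMat σ, rotMat_mem σ⟩, rotMat_mulVec_octahedron σ⟩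
  map_one' := Subtype.ext (Subtype.ext rotMat_one)
  map_mul' σ τ := Subtype.ext (Subtype.ext (rotMat_mul σ τ))

theorem octMat_octHom (σ : Equiv.Perm (Fin 4)) : octMat (octHom σ) = rotMat σ := rfl

theorem octHom_injective : Function.Injective octHom := by
  rw [injective_iff_map_eq_one]
  intro σ h
  refine eq_one_of_sign_smul_tetMat σ ?_
  have h1 : rotMat σ = 1 := by rw [← octMat_octHom, h, octMat_one]
  rw [rotMat, ← map_one (Int.castRingHom ℝ).mapMatrix] at h1
  exact Matrix.map_injective (RingHom.injective_int (Int.castRingHom ℝ)) h1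

theorem exists_signedPermMat (Q : octGroup) : ∃ (π : Equiv.Perm (Fin 3)) (δ : Fin 3 → ℤˣ),
    octMat Q = (Int.castRingHom ℝ).mapMatrix (signedPermMat π δ) := by
  have hQ : (fun v => (octMat Q).mulVec v) '' octahedron = octahedron := Q.2
  have hcol : ∀ k, ∃ (l : Fin 3) (u : ℤˣ), ∀ α,
      octMat Q α k = if α = l then ((u : ℤ) : ℝ) else 0 := by
    intro k
    have hm : (octMat Q).mulVec (Pi.single k 1) ∈ octahedron := by
      rw [← hQ]
      exact ⟨_, ⟨k, Or.inl rfl⟩, rfl⟩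
    obtain ⟨l, hl⟩ := hm
    rw [Matrix.mulVec_single_one] at hl
    rcases hl with hl | hl
    · refine ⟨l, 1, fun α => ?_⟩
      have := congrFun hl α
      rw [Matrix.col_apply] at this
      simp [this, Pi.single_apply]
    · refine ⟨l, -1, fun α => ?_⟩
      have := congrFun hl α
      rw [Matrix.col_apply] at this
      rw [this]
      by_cases h : α = l <;> simp [h]
  choose p δ hp using hcol
  have hinj : Function.Injective p := by
    intro k l hkl
    by_contra hne
    have h := congrFun (congrFun (octMat_transpose_mul Q) k) l
    rw [Matrix.one_apply_ne hne, Matrix.mul_apply, Finset.sum_eq_single (p k)] at h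
    · rw [Matrix.transpose_apply, hp, hp, if_pos rfl, if_pos hkl] at h
      rcases units_cast (δ k) with h1 | h1 <;> rcases units_cast (δ l) with h2 | h2 <;>
        simp [h1, h2] at h
    · intro b _ hb
      rw [Matrix.transpose_apply, hp, if_neg hb, zero_mul]
    · simp
  refine ⟨Equiv.ofBijective p (Finite.injective_iff_bijective.1 hinj), δ, ?_⟩
  ext α β
  rw [hp]
  simp [signedPermMat]

theorem octHom_surjective : Function.Surjective octHom := by
  intro Q
  obtain ⟨π, δ, h⟩ := exists_signedPermMat Q
  have hdet : (octMat Q).det = 1 := (Matrix.mem_specialOrthogonalGroup_iff.1 Q.1.2).2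
  rw [h, ← RingHom.map_det, det_signedPermMat] at hdet
  have h1 : Equiv.Perm.sign π * (δ 0 * δ 1 * δ 2) = 1 := by
    refine Units.ext ?_
    rw [eq_intCast] at hdet
    rw [Units.val_one]
    exact Int.cast_injective (α := ℝ) (hdet.trans Int.cast_one.symm)
  obtain ⟨σ, hσ⟩ := exists_sign_smul_tetMat π δ h1
  refine ⟨σ, Subtype.ext (Subtype.ext ?_)⟩
  change rotMat σ = octMat Q
  rw [h, rotMat, hσ]

/-- The group of rotations of the octahedron is isomorphic to `S₄`. -/
noncomputable def octEquiv : Equiv.Perm (Fin 4) ≃* octGroup :=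
  MulEquiv.ofBijective octHom ⟨octHom_injective, octHom_surjective⟩

theorem coe_octEquiv_smul (σ : Equiv.Perm (Fin 4)) (M : ksSpace) :
    ((octEquiv σ • M : ksSpace) : Matrix (Fin 3) (Fin 3) ℝ) =
      rotMat σ * M * (rotMat σ).transpose := rfl

theorem det_octEquiv_smul (σ : Equiv.Perm (Fin 4)) (M : ksSpace) :
    ((octEquiv σ • M : ksSpace) : Matrix (Fin 3) (Fin 3) ℝ).det =
      (M : Matrix (Fin 3) (Fin 3) ℝ).det := by
  have h := (Matrix.mem_specialOrthogonalGroup_iff.1 (rotMat_mem σ)).2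
  rw [coe_octEquiv_smul, Matrix.det_mul, Matrix.det_mul, Matrix.det_transpose, h]
  ring

theorem octEquiv_smul_mem_ksVariety (σ : Equiv.Perm (Fin 4)) {p : ℙ ℝ ksSpace}
    (hp : p ∈ ksVariety) : octEquiv σ • p ∈ ksVariety := by
  induction p using Projectivization.ind with
  | h v hv =>
    rw [Projectivization.smul_mk, mk_mem_ksVariety_iff, det_octEquiv_smul]
    exact (mk_mem_ksVariety_iff v hv).1 hp

/-- The rotation and the tetrahedral isometry differ by a sign, which conjugation does not see. -/
theorem octEquiv_smul_apply {σ : Equiv.Perm (Fin 4)} {π : Equiv.Perm (Fin 3)} {ε : Fin 3 → ℤˣ}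
    (h : IsSignedPermOf σ π ε) (M : ksSpace) (α β : Fin 3) :
    ((octEquiv σ • M : ksSpace) : Matrix (Fin 3) (Fin 3) ℝ) (π α) (π β) =
      ((ε α : ℤ) : ℝ) * ((ε β : ℤ) : ℝ) * (M : Matrix (Fin 3) (Fin 3) ℝ) α β := by
  rw [coe_octEquiv_smul, Matrix.mul_apply, Finset.sum_eq_single β, Matrix.mul_apply,
    Finset.sum_eq_single α, Matrix.transpose_apply, rotMat_apply h, rotMat_apply h, if_pos rfl,
    if_pos rfl]
  · have h1 : ((Equiv.Perm.sign σ : ℤ) : ℝ) * ((Equiv.Perm.sign σ : ℤ) : ℝ) = 1 := by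
      exact_mod_cast sign_mul_self σ
    linear_combination ((ε α : ℤ) : ℝ) * ((ε β : ℤ) : ℝ) * (M : Matrix (Fin 3) (Fin 3) ℝ) α β * h1
  · intro γ _ hγ
    rw [rotMat_apply h, if_neg fun he => hγ (π.injective he).symm, zero_mul]
  · simp
  · intro γ _ hγ
    rw [Matrix.transpose_apply, rotMat_apply h, if_neg fun he => hγ (π.injective he).symm,
      mul_zero]
  · simp

theorem perm_fin_three_cases : ∀ π : Equiv.Perm (Fin 3),
    (π 0 = 0 ∧ π 1 = 1 ∧ π 2 = 2 ∧ Equiv.Perm.sign π = 1) ∨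
    (π 0 = 1 ∧ π 1 = 2 ∧ π 2 = 0 ∧ Equiv.Perm.sign π = 1) ∨
    (π 0 = 2 ∧ π 1 = 0 ∧ π 2 = 1 ∧ Equiv.Perm.sign π = 1) ∨
    (π 0 = 1 ∧ π 1 = 0 ∧ π 2 = 2 ∧ Equiv.Perm.sign π = -1) ∨
    (π 0 = 2 ∧ π 1 = 1 ∧ π 2 = 0 ∧ Equiv.Perm.sign π = -1) ∨
    (π 0 = 0 ∧ π 1 = 2 ∧ π 2 = 1 ∧ Equiv.Perm.sign π = -1) := by
  decide +kernel

/-- The off-diagonal part of `M` is the cross product matrix of `t`, which an orthogonal `P`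
conjugates to `det P` times that of `P t`; here `det P = sgn π`. The diagonal consists of cyclic
differences of the `w_α`, which odd permutations also reverse. Since the `w_α` sum to zero, their
differences determine them. -/
theorem ksMatrix_conj_iff {π : Equiv.Perm (Fin 3)} {u : Fin 3 → ℝ} (hu : ∀ α, u α = 1 ∨ u α = -1)
    (hprod : u 0 * u 1 * u 2 = 1) {w t w' t' : Fin 3 → ℝ}
    (hw : w 0 + w 1 + w 2 = 0) (hw' : w' 0 + w' 1 + w' 2 = 0) :
    (∀ α β, ksMatrix w' t' (π α) (π β) =
      ((Equiv.Perm.sign π : ℤ) : ℝ) * (u α * u β * ksMatrix w t α β)) ↔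
      ∀ α, w' (π α) = w α ∧ t' (π α) = u α * t α := by
  have sq : ∀ α, u α * u α = 1 := fun α => by rcases hu α with h | h <;> simp [h]
  -- Three signs with product one: any two of them multiply to the third.
  have u01 : u 0 * u 1 = u 2 := by linear_combination u 2 * hprod - u 0 * u 1 * sq 2
  have u12 : u 1 * u 2 = u 0 := by linear_combination u 0 * hprod - u 1 * u 2 * sq 0
  have u20 : u 2 * u 0 = u 1 := by linear_combination u 1 * hprod - u 0 * u 2 * sq 1
  have u10 : u 1 * u 0 = u 2 := by rw [mul_comm, u01]
  have u21 : u 2 * u 1 = u 0 := by rw [mul_comm, u12]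
  have u02 : u 0 * u 2 = u 1 := by rw [mul_comm, u20]
  have k : ∀ w t : Fin 3 → ℝ, ksMatrix w t 0 0 = w 1 - w 2 ∧ ksMatrix w t 1 1 = w 2 - w 0 ∧
      ksMatrix w t 2 2 = w 0 - w 1 ∧ ksMatrix w t 0 1 = -t 2 ∧ ksMatrix w t 1 0 = t 2 ∧
      ksMatrix w t 0 2 = t 1 ∧ ksMatrix w t 2 0 = -t 1 ∧ ksMatrix w t 1 2 = -t 0 ∧
      ksMatrix w t 2 1 = t 0 := fun w t => ⟨rfl, rfl, rfl, rfl, rfl, rfl, rfl, rfl, rfl⟩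
  obtain ⟨a1, a2, a3, a4, a5, a6, a7, a8, a9⟩ := k w t
  obtain ⟨b1, b2, b3, b4, b5, b6, b7, b8, b9⟩ := k w' t'
  simp only [Fin.forall_fin_succ, Fin.forall_fin_zero, Fin.succ_zero_eq_one, Fin.succ_one_eq_two,
    Fin.isValue, and_true, a1, a2, a3, a4, a5, a6, a7, a8, a9, sq, u01, u12, u20, u10, u21, u02]
  rcases perm_fin_three_cases π with ⟨p0, p1, p2, hs⟩ | ⟨p0, p1, p2, hs⟩ | ⟨p0, p1, p2, hs⟩ |
    ⟨p0, p1, p2, hs⟩ | ⟨p0, p1, p2, hs⟩ | ⟨p0, p1, p2, hs⟩ <;>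
  simp only [p0, p1, p2, hs, b1, b2, b3, b4, b5, b6, b7, b8, b9, Units.val_one, Units.val_neg,
    Int.cast_one, Int.cast_neg] <;>
  constructor
  all_goals first
    | rintro ⟨⟨h1, h2, h3⟩, ⟨h4, h5, h6⟩, h7, h8, h9⟩
      refine ⟨⟨?_, ?_⟩, ⟨?_, ?_⟩, ?_, ?_⟩ <;> linarith
    | rintro ⟨⟨h1, h2⟩, ⟨h3, h4⟩, h5, h6⟩
      refine ⟨⟨?_, ?_, ?_⟩, ⟨?_, ?_, ?_⟩, ?_, ?_, ?_⟩ <;> linarith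

theorem ksElem_eq_sign_smul_iff {σ : Equiv.Perm (Fin 4)} {π : Equiv.Perm (Fin 3)}
    {ε : Fin 3 → ℤˣ} (h : IsSignedPermOf σ π ε) {w t w' t' : Fin 3 → ℝ}
    (hw : w 0 + w 1 + w 2 = 0) (hw' : w' 0 + w' 1 + w' 2 = 0) :
    ksElem w' t' = ((Equiv.Perm.sign σ : ℤ) : ℝ) • octEquiv σ • ksElem w t ↔
      ∀ α, w' (π α) = w α ∧ t' (π α) = ((ε α : ℤ) : ℝ) * t α := by
  have h1 : ksElem w' t' = ((Equiv.Perm.sign σ : ℤ) : ℝ) • octEquiv σ • ksElem w t ↔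
      ∀ α β, ksMatrix w' t' (π α) (π β) = ((Equiv.Perm.sign π : ℤ) : ℝ) *
        (((ε α : ℤ) : ℝ) * ((ε β : ℤ) : ℝ) * ksMatrix w t α β) := by
    have h2 : ∀ α β, ((((Equiv.Perm.sign σ : ℤ) : ℝ) • octEquiv σ • ksElem w t : ksSpace) :
        Matrix (Fin 3) (Fin 3) ℝ) (π α) (π β) = ((Equiv.Perm.sign π : ℤ) : ℝ) *
        (((ε α : ℤ) : ℝ) * ((ε β : ℤ) : ℝ) * ksMatrix w t α β) := by
      intro α β
      rw [h.2.1, Submodule.coe_smul, Matrix.smul_apply, octEquiv_smul_apply h, smul_eq_mul]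
      rfl
    constructor
    · intro he α β
      rw [← h2, ← he]
      rfl
    · intro he
      refine Subtype.ext ?_
      ext i j
      obtain ⟨α, rfl⟩ := π.surjective i
      obtain ⟨β, rfl⟩ := π.surjective j
      rw [h2, ← he]
      rfl
  rw [h1]
  refine ksMatrix_conj_iff (fun α => units_cast (ε α)) ?_ hw hw'
  rw [← Int.cast_mul, ← Int.cast_mul, ← Units.val_mul, ← Units.val_mul, h.1, Units.val_one,
    Int.cast_one]

end OctahedralGroup

/-! ### Permutations of the basis as isometries -/

section PermutationIsometries

variable {V : Type*} [NormedAddCommGroup V] [InnerProductSpace ℝ V]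

/-- This form makes the symmetry visible: permuting the indices of the basis moves the vertices of
the tetrahedron, hence the coordinates of `w` and `t`. -/
theorem paramCoeff_eq {w : Fin 3 → ℝ} (hw : w 0 + w 1 + w 2 = 0) (t : Fin 3 → ℝ) (s : ℝ)
    {i j : Fin 4} (hij : i ≠ j) :
    paramCoeff w t s i j = 1 / 2 * ∑ β, (tet i β : ℝ) * tet j β * w β +
      1 / 2 * ∑ β, ((tet i β : ℝ) + tet j β) * t β + s / 12 := by
  have h2 : w 2 = -w 0 - w 1 := by linarith
  fin_cases i <;> fin_cases j <;> first
    | exact absurd rfl hij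
    | simp [paramCoeff, tet, Fin.sum_univ_three, h2]
      ring

/-- The signs cancel in the part quadratic in the vertices, so `w` is merely permuted, while the
linear part transfers them to `t`. -/
theorem paramCoeff_perm {σ : Equiv.Perm (Fin 4)} {π : Equiv.Perm (Fin 3)}
    {ε : Fin 3 → ℤˣ} (h : IsSignedPermOf σ π ε) {w t w' t' : Fin 3 → ℝ}
    (hw : w 0 + w 1 + w 2 = 0) (hw' : w' 0 + w' 1 + w' 2 = 0)
    (he : ∀ α, w' (π α) = w α ∧ t' (π α) = ((ε α : ℤ) : ℝ) * t α) (s : ℝ) (i j : Fin 4) :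
    paramCoeff w' t' s (σ i) (σ j) = paramCoeff w t s i j := by
  by_cases hij : i = j
  · subst hij
    have h0 : ∀ (w t : Fin 3 → ℝ) (i : Fin 4), paramCoeff w t s i i = 0 := by
      intro w t i
      fin_cases i <;> rfl
    rw [h0, h0]
  · have hc : ∀ i β, (tet (σ i) (π β) : ℝ) = ((ε β : ℤ) : ℝ) * tet i β := by
      intro i β
      rw [h.2.2.2]
      push_cast
      rfl
    have sq : ∀ β, ((ε β : ℤ) : ℝ) * ((ε β : ℤ) : ℝ) = 1 := fun β => by
      rcases units_cast (ε β) with h | h <;> simp [h]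
    rw [paramCoeff_eq hw' t' s fun hs => hij (σ.injective hs), paramCoeff_eq hw t s hij,
      ← Equiv.sum_comp π, ← Equiv.sum_comp π fun β => ((tet (σ i) β : ℝ) + tet (σ j) β) * t' β]
    congr 3 <;> refine Finset.sum_congr rfl fun β _ => ?_
    · rw [hc, hc, (he β).1]
      linear_combination (tet i β : ℝ) * tet j β * w β * sq β
    · rw [hc, hc, (he β).2]
      linear_combination ((tet i β : ℝ) + tet j β) * t β * sq β

theorem repr_equiv_perm (e : OrthonormalBasis (Fin 4) ℝ V) (σ : Equiv.Perm (Fin 4)) (a : V)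
    (i : Fin 4) : e.repr (e.equiv e σ a) (σ i) = e.repr a i := by
  rw [e.repr_apply_apply, e.repr_apply_apply, ← OrthonormalBasis.equiv_apply_basis e e σ i,
    LinearIsometryEquiv.inner_map_map]

theorem diagTensor_equiv_perm (e : OrthonormalBasis (Fin 4) ℝ V) (σ : Equiv.Perm (Fin 4))
    {r r' : Fin 4 → Fin 4 → ℝ} (h : ∀ i j, r' (σ i) (σ j) = r i j) (a b c d : V) :
    diagTensor e r' (e.equiv e σ a) (e.equiv e σ b) (e.equiv e σ c) (e.equiv e σ d) =
      diagTensor e r a b c d := by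
  rw [diagTensor_apply, diagTensor_apply, ← Equiv.sum_comp σ]
  refine Finset.sum_congr rfl fun i _ => ?_
  rw [← Equiv.sum_comp σ]
  refine Finset.sum_congr rfl fun j _ => ?_
  simp only [repr_equiv_perm, h]

end PermutationIsometries

/-! ### Recovering triples from symmetric functions -/

section PowerSums

theorem exists_perm_fin_three : ∀ a b c : Fin 3, a ≠ b → b ≠ c → a ≠ c →
    ∃ π : Equiv.Perm (Fin 3), π 0 = a ∧ π 1 = b ∧ π 2 = c := by
  decide

theorem exists_perm_of_power_sums {x y : Fin 3 → ℝ} (h1 : x 0 + x 1 + x 2 = y 0 + y 1 + y 2)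
    (h2 : x 0 ^ 2 + x 1 ^ 2 + x 2 ^ 2 = y 0 ^ 2 + y 1 ^ 2 + y 2 ^ 2)
    (h3 : x 0 ^ 3 + x 1 ^ 3 + x 2 ^ 3 = y 0 ^ 3 + y 1 ^ 3 + y 2 ^ 3) :
    ∃ π : Equiv.Perm (Fin 3), ∀ α, y (π α) = x α := by
  have key : ∀ a b c : Fin 3, a ≠ b → b ≠ c → a ≠ c → x 0 = y a → x 1 = y b → x 2 = y c →
      ∃ π : Equiv.Perm (Fin 3), ∀ α, y (π α) = x α := by
    intro a b c hab hbc hac h0 h1 h2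
    obtain ⟨π, p0, p1, p2⟩ := exists_perm_fin_three a b c hab hbc hac
    refine ⟨π, fun α => ?_⟩
    fin_cases α
    · exact (congrArg y p0).trans h0.symm
    · exact (congrArg y p1).trans h1.symm
    · exact (congrArg y p2).trans h2.symm
  have e2 : x 0 * x 1 + x 0 * x 2 + x 1 * x 2 = y 0 * y 1 + y 0 * y 2 + y 1 * y 2 := by
    linear_combination (x 0 + x 1 + x 2 + y 0 + y 1 + y 2) / 2 * h1 - h2 / 2
  have e3 : x 0 * x 1 * x 2 = y 0 * y 1 * y 2 := by
    linear_combination h3 / 3 -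
      (x 0 ^ 2 + x 1 ^ 2 + x 2 ^ 2 - (x 0 * x 1 + x 0 * x 2 + x 1 * x 2)) / 3 * h1
      - (y 0 + y 1 + y 2) / 3 * (h2 - e2)
  have two : ∀ {p q r s : ℝ}, p + q = r + s → p * q = r * s →
      (p = r ∧ q = s) ∨ (p = s ∧ q = r) := by
    intro p q r s hs hp
    have : (p - r) * (p - s) = 0 := by linear_combination p * hs - hp
    rcases mul_eq_zero.1 this with h | h
    · exact Or.inl ⟨by linarith, by linarith⟩
    · exact Or.inr ⟨by linarith, by linarith⟩
  -- By Newton's identities `e2` and `e3`, `x 0` is a root of the monic cubic with roots `y 0, y 1,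
  -- y 2`.
  have h0 : (x 0 - y 0) * ((x 0 - y 1) * (x 0 - y 2)) = 0 := by
    linear_combination x 0 ^ 2 * h1 - x 0 * e2 + e3
  rcases mul_eq_zero.1 h0 with h | h
  · have hx : x 0 = y 0 := by linarith
    have hs : x 1 + x 2 = y 1 + y 2 := by linarith
    rcases two hs (by rw [hx] at e2; linear_combination e2 - y 0 * hs) with ⟨ha, hb⟩ | ⟨ha, hb⟩
    · exact key 0 1 2 (by decide) (by decide) (by decide) hx ha hb
    · exact key 0 2 1 (by decide) (by decide) (by decide) hx ha hb
  rcases mul_eq_zero.1 h with h | h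
  · have hx : x 0 = y 1 := by linarith
    have hs : x 1 + x 2 = y 0 + y 2 := by linarith
    rcases two hs (by rw [hx] at e2; linear_combination e2 - y 1 * hs) with ⟨ha, hb⟩ | ⟨ha, hb⟩
    · exact key 1 0 2 (by decide) (by decide) (by decide) hx ha hb
    · exact key 1 2 0 (by decide) (by decide) (by decide) hx ha hb
  · have hx : x 0 = y 2 := by linarith
    have hs : x 1 + x 2 = y 0 + y 1 := by linarith
    rcases two hs (by rw [hx] at e2; linear_combination e2 - y 2 * hs) with ⟨ha, hb⟩ | ⟨ha, hb⟩
    · exact key 2 0 1 (by decide) (by decide) (by decide) hx ha hb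
    · exact key 2 1 0 (by decide) (by decide) (by decide) hx ha hb

/-- Two distinct pairs have the same combination for at most one value of `c`, so finitely many
values must be avoided. -/
theorem exists_generic_combination {ι : Type*} [Fintype ι] (w a w' a' : ι → ℝ) :
    ∃ c : ℝ, ∀ i j, w i + c * a i = w' j + c * a' j → w i = w' j ∧ a i = a' j := by
  classical
  -- Where the denominator vanishes the quotient is `0`, which merely excludes one more value.
  obtain ⟨c, hc⟩ := Infinite.exists_notMem_finset
    (Finset.univ.image fun p : ι × ι => (w' p.2 - w p.1) / (a p.1 - a' p.2))
  refine ⟨c, fun i j h => ?_⟩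
  have ha : a i = a' j := by
    by_contra hne
    refine hc (Finset.mem_image.2 ⟨(i, j), Finset.mem_univ _, ?_⟩)
    rw [div_eq_iff (sub_ne_zero.2 hne)]
    linarith
  rw [ha] at h
  exact ⟨by linarith, ha⟩

/-- If signs chosen one by one have product `-1`, equality of the products forces some `x α = 0`,
and the sign there can be flipped freely. -/
theorem exists_signs {x y : Fin 3 → ℝ} (h : ∀ α, y α ^ 2 = x α ^ 2)
    (hp : y 0 * y 1 * y 2 = x 0 * x 1 * x 2) :
    ∃ ε : Fin 3 → ℤˣ, ε 0 * ε 1 * ε 2 = 1 ∧ ∀ α, y α = ((ε α : ℤ) : ℝ) * x α := by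
  have hv : ∀ α, ∃ u : ℤˣ, y α = ((u : ℤ) : ℝ) * x α := by
    intro α
    rcases sq_eq_sq_iff_eq_or_eq_neg.1 (h α) with h | h
    · exact ⟨1, by simp [h]⟩
    · exact ⟨-1, by simp [h]⟩
  choose v hv using hv
  rcases Int.units_eq_one_or (v 0 * v 1 * v 2) with h1 | h1
  · exact ⟨v, h1, hv⟩
  · have h2 : ((v 0 : ℤ) : ℝ) * ((v 1 : ℤ) : ℝ) * ((v 2 : ℤ) : ℝ) = -1 := by
      rw [← Int.cast_mul, ← Int.cast_mul, ← Units.val_mul, ← Units.val_mul, h1]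
      simp
    rw [hv 0, hv 1, hv 2] at hp
    have h3 : x 0 * x 1 * x 2 = 0 := by
      linear_combination (x 0 * x 1 * x 2) / 2 * h2 - hp / 2
    have flip : ∀ k, x k = 0 → ∀ α,
        y α = ((Function.update v k (-v k) α : ℤˣ) : ℤ) * x α := by
      intro k hk α
      by_cases hα : α = k
      · subst hα
        rw [hv, hk]
        simp
      · rw [Function.update_of_ne hα, hv]
    rcases mul_eq_zero.1 h3 with h3 | h3
    · rcases mul_eq_zero.1 h3 with h3 | h3
      · refine ⟨_, ?_, flip 0 h3⟩
        simpa [neg_eq_iff_eq_neg] using h1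
      · refine ⟨_, ?_, flip 1 h3⟩
        simpa [neg_eq_iff_eq_neg] using h1
    · refine ⟨_, ?_, flip 2 h3⟩
      simpa [neg_eq_iff_eq_neg] using h1

end PowerSums

/-! ### Invariants of curvature tensors under isometries -/

section Invariants

open scoped Kronecker

variable {V : Type*} [NormedAddCommGroup V] [InnerProductSpace ℝ V]

/-- The matrix of an isometry in an orthonormal basis. -/
noncomputable def isomMat (e : OrthonormalBasis (Fin 4) ℝ V) (U : V ≃ₗᵢ[ℝ] V) :
    Matrix (Fin 4) (Fin 4) ℝ :=
  Matrix.of fun i j => e.repr (U (e j)) i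

theorem map_basis_eq (e : OrthonormalBasis (Fin 4) ℝ V) (U : V ≃ₗᵢ[ℝ] V) (j : Fin 4) :
    U (e j) = ∑ i, isomMat e U i j • e i :=
  (e.sum_repr (U (e j))).symm

theorem isomMat_transpose_mul (e : OrthonormalBasis (Fin 4) ℝ V) (U : V ≃ₗᵢ[ℝ] V) :
    (isomMat e U).transpose * isomMat e U = 1 := by
  ext i j
  have h := inner_eq_sum_repr e (U (e i)) (U (e j))
  rw [LinearIsometryEquiv.inner_map_map, orthonormal_iff_ite.1 e.orthonormal] at h
  rw [Matrix.one_apply, h]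
  rfl

/-- A four-tensor as a bilinear form on pairs of indices. -/
noncomputable def tensorMat (e : OrthonormalBasis (Fin 4) ℝ V) (R : FourTensor V) :
    Matrix (Fin 4 × Fin 4) (Fin 4 × Fin 4) ℝ :=
  Matrix.of fun p q => R (e p.1) (e p.2) (e q.1) (e q.2)

/-- The Ricci contraction of a four-tensor. -/
noncomputable def ricciMat (e : OrthonormalBasis (Fin 4) ℝ V) (R : FourTensor V) :
    Matrix (Fin 4) (Fin 4) ℝ :=
  Matrix.of fun i k => ∑ j, R (e i) (e j) (e k) (e j)

theorem tensorMat_isometry (e : OrthonormalBasis (Fin 4) ℝ V) {R R' : FourTensor V}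
    {U : V ≃ₗᵢ[ℝ] V} (h : ∀ a b c d, R' (U a) (U b) (U c) (U d) = R a b c d) :
    tensorMat e R = (isomMat e U ⊗ₖ isomMat e U).transpose * tensorMat e R' *
      (isomMat e U ⊗ₖ isomMat e U) := by
  ext ⟨i, j⟩ ⟨k, l⟩
  simp only [tensorMat, Matrix.of_apply, ← h, Matrix.mul_apply, Matrix.transpose_apply,
    Matrix.kroneckerMap_apply, Fintype.sum_prod_type, Finset.sum_mul]
  simp only [map_basis_eq, map_sum, map_smul, LinearMap.sum_apply, LinearMap.smul_apply,
    smul_eq_mul, Finset.mul_sum]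
  rw [Finset.sum_comm]
  refine Finset.sum_congr rfl fun c _ => Finset.sum_congr rfl fun d _ => ?_
  rw [Finset.sum_comm]
  refine Finset.sum_congr rfl fun a _ => Finset.sum_congr rfl fun b _ => ?_
  ring

theorem sum_diag_isometry (e : OrthonormalBasis (Fin 4) ℝ V) (U : V ≃ₗᵢ[ℝ] V)
    (B : Fin 4 → Fin 4 → ℝ) :
    ∑ j, ∑ b, ∑ d, isomMat e U b j * (isomMat e U d j * B b d) = ∑ b, B b b := by
  have h1 : isomMat e U * (isomMat e U).transpose = 1 :=
    mul_eq_one_comm.1 (isomMat_transpose_mul e U)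
  calc _ = ∑ b, ∑ d, (isomMat e U * (isomMat e U).transpose) b d * B b d := by
        rw [Finset.sum_comm]
        refine Finset.sum_congr rfl fun b _ => ?_
        rw [Finset.sum_comm]
        refine Finset.sum_congr rfl fun d _ => ?_
        rw [Matrix.mul_apply, Finset.sum_mul]
        refine Finset.sum_congr rfl fun j _ => ?_
        rw [Matrix.transpose_apply, mul_assoc]
    _ = _ := by
        rw [h1]
        simp [Matrix.one_apply]

theorem ricciMat_isometry (e : OrthonormalBasis (Fin 4) ℝ V) {R R' : FourTensor V}
    {U : V ≃ₗᵢ[ℝ] V} (h : ∀ a b c d, R' (U a) (U b) (U c) (U d) = R a b c d) :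
    ricciMat e R = (isomMat e U).transpose * ricciMat e R' * isomMat e U := by
  ext i k
  have h1 : ricciMat e R i k = ∑ b, R' (U (e i)) (e b) (U (e k)) (e b) := by
    rw [← sum_diag_isometry e U fun b d => R' (U (e i)) (e b) (U (e k)) (e d)]
    simp only [ricciMat, Matrix.of_apply, ← h]
    refine Finset.sum_congr rfl fun j _ => ?_
    rw [map_basis_eq e U j]
    simp only [map_sum, map_smul, LinearMap.sum_apply, LinearMap.smul_apply,
      smul_eq_mul, Finset.mul_sum]
    rw [Finset.sum_comm]
    refine Finset.sum_congr rfl fun b _ => Finset.sum_congr rfl fun d _ => ?_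
    ring
  rw [h1]
  simp only [ricciMat, Matrix.mul_apply, Matrix.transpose_apply, Matrix.of_apply, map_basis_eq,
    map_sum, map_smul, LinearMap.sum_apply, LinearMap.smul_apply, smul_eq_mul, Finset.mul_sum,
    Finset.sum_mul]
  rw [Finset.sum_comm]
  refine Finset.sum_congr rfl fun c _ => ?_
  rw [Finset.sum_comm]
  refine Finset.sum_congr rfl fun a _ => Finset.sum_congr rfl fun b _ => ?_
  ring

/-- The matrix on pairs of indices of the diagonal tensor with entries `d`. -/
def pairMat (d : Fin 4 → Fin 4 → ℝ) : Matrix (Fin 4 × Fin 4) (Fin 4 × Fin 4) ℝ :=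
  Matrix.of fun p q => d p.1 p.2 * ((if p = q then 1 else 0) - if p = q.swap then 1 else 0)

theorem tensorMat_diagTensor (e : OrthonormalBasis (Fin 4) ℝ V) (r : Fin 4 → Fin 4 → ℝ) :
    tensorMat e (diagTensor e r) = pairMat r := by
  ext ⟨i, j⟩ ⟨k, l⟩
  simp only [tensorMat, pairMat, Matrix.of_apply, diagTensor_basis, Prod.mk.injEq,
    Prod.swap_prod_mk]
  by_cases h1 : i = k <;> by_cases h2 : j = l <;> by_cases h3 : i = l <;> by_cases h4 : j = k <;>
    simp_all [eq_comm]

theorem ricciMat_diagTensor (e : OrthonormalBasis (Fin 4) ℝ V) {r : Fin 4 → Fin 4 → ℝ}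
    (hr : ∀ i, r i i = 0) :
    ricciMat e (diagTensor e r) = Matrix.diagonal fun i => ∑ j, r i j := by
  ext i k
  simp only [ricciMat, Matrix.of_apply, diagTensor_basis, Matrix.diagonal_apply]
  by_cases h : i = k
  · subst h
    simp only [and_true, if_true]
    refine Finset.sum_congr rfl fun j _ => ?_
    by_cases hj : i = j
    · subst hj; simp [hr]
    · simp [hj]
  · simp only [h, false_and, if_false]
    refine Finset.sum_eq_zero fun j _ => ?_
    rw [if_neg]
    rintro ⟨rfl, rfl⟩
    exact h rfl

/-- The antisymmetriser `1 - swap` squares to twice itself and commutes with symmetric coefficients.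
-/
theorem pairMat_mul (d d' : Fin 4 → Fin 4 → ℝ) (hd' : ∀ i j, d' i j = d' j i) :
    pairMat d * pairMat d' = pairMat fun i j => 2 * (d i j * d' i j) := by
  ext p q
  simp only [pairMat, Matrix.mul_apply, Matrix.of_apply]
  have h : ∀ m : Fin 4 × Fin 4,
      d p.1 p.2 * ((if p = m then 1 else 0) - if p = m.swap then 1 else 0) *
      (d' m.1 m.2 * ((if m = q then 1 else 0) - if m = q.swap then 1 else 0)) =
      (if p = m then d p.1 p.2 *
        (d' m.1 m.2 * ((if m = q then 1 else 0) - if m = q.swap then 1 else 0)) else 0) -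
      if p.swap = m then d p.1 p.2 *
        (d' m.1 m.2 * ((if m = q then 1 else 0) - if m = q.swap then 1 else 0)) else 0 := by
    intro m
    have : p = m.swap ↔ p.swap = m := by
      constructor
      · rintro rfl; simp
      · rintro rfl; simp
    simp only [this]
    split_ifs <;> ring
  simp only [h, Finset.sum_sub_distrib, Finset.sum_ite_eq, Finset.mem_univ, if_true]
  have h1 : p.swap = q ↔ p = q.swap := by
    constructor
    · rintro rfl; simp
    · rintro rfl; simp
  simp only [h1, Prod.swap_inj, Prod.fst_swap, Prod.snd_swap, hd' p.2 p.1]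
  ring

theorem diagonal_mul_pairMat (k d : Fin 4 → Fin 4 → ℝ) :
    Matrix.diagonal (fun p : Fin 4 × Fin 4 => k p.1 p.2) * pairMat d =
      pairMat fun i j => k i j * d i j := by
  ext p q
  rw [Matrix.diagonal_mul]
  simp only [pairMat, Matrix.of_apply]
  ring

/-- The symmetric function on pairs `i ≠ j` which only depends on the splitting `ij|kl`. -/
def splitCoeff (x : Fin 3 → ℝ) : Fin 4 → Fin 4 → ℝ :=
  ![![0, x 0, x 1, x 2], ![x 0, 0, x 2, x 1], ![x 1, x 2, 0, x 0], ![x 2, x 1, x 0, 0]]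

theorem splitCoeff_symm (x : Fin 3 → ℝ) (i j : Fin 4) : splitCoeff x i j = splitCoeff x j i := by
  fin_cases i <;> fin_cases j <;> rfl

theorem pairMat_splitCoeff_mul (x y : Fin 3 → ℝ) :
    pairMat (splitCoeff x) * pairMat (splitCoeff y) =
      pairMat (splitCoeff fun α => 2 * (x α * y α)) := by
  rw [pairMat_mul _ _ (splitCoeff_symm y)]
  congr 1
  funext i j
  fin_cases i <;> fin_cases j <;> simp [splitCoeff]

theorem trace_pairMat_splitCoeff (x : Fin 3 → ℝ) :
    (pairMat (splitCoeff x)).trace = 4 * (x 0 + x 1 + x 2) := by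
  simp [Matrix.trace, pairMat, Fintype.sum_prod_type, Fin.sum_univ_four, splitCoeff]
  ring

/-- The antisymmetriser kills `e i ⊗ e i`, so the coefficients `d i i` play no role. -/
theorem pairMat_congr {d d' : Fin 4 → Fin 4 → ℝ} (h : ∀ i j, i ≠ j → d i j = d' i j) :
    pairMat d = pairMat d' := by
  ext ⟨i, j⟩ q
  by_cases hij : i = j
  · subst hij
    have h1 : ((i, i) : Fin 4 × Fin 4) = q ↔ ((i, i) : Fin 4 × Fin 4) = q.swap := by
      constructor
      · rintro rfl; rfl
      · intro h
        rw [← Prod.swap_swap q, ← h]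
        rfl
    simp [pairMat, h1]
  · simp [pairMat, h i j hij]

theorem diagTensor_one (e : OrthonormalBasis (Fin 4) ℝ V) (a b c d : V) :
    diagTensor e (fun _ _ => 1) a b c d =
      inner ℝ a c * inner ℝ b d - inner ℝ a d * inner ℝ b c := by
  simp only [diagTensor_apply, inner_eq_sum_repr e, Finset.sum_mul_sum, ← Finset.sum_sub_distrib]
  refine Finset.sum_congr rfl fun i _ => Finset.sum_congr rfl fun j _ => ?_
  ring

/-- The trace free Ricci contraction, acting on pairs of indices as a derivation. -/
noncomputable def ricciPairMat (e : OrthonormalBasis (Fin 4) ℝ V) (R : FourTensor V) (s : ℝ) :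
    Matrix (Fin 4 × Fin 4) (Fin 4 × Fin 4) ℝ :=
  (ricciMat e R - (s / 4) • (1 : Matrix (Fin 4) (Fin 4) ℝ)) ⊗ₖ (1 : Matrix (Fin 4) (Fin 4) ℝ) +
    (1 : Matrix (Fin 4) (Fin 4) ℝ) ⊗ₖ (ricciMat e R - (s / 4) • (1 : Matrix (Fin 4) (Fin 4) ℝ))

/-- A combination of the Weyl part and the square of the trace free Ricci part of a curvature
tensor with scalar curvature `s`. -/
noncomputable def weylMat (e : OrthonormalBasis (Fin 4) ℝ V) (R : FourTensor V) (s c : ℝ) :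
    Matrix (Fin 4 × Fin 4) (Fin 4 × Fin 4) ℝ :=
  tensorMat e R + (-(1 / 2) : ℝ) • (ricciPairMat e R s * tensorMat e (diagTensor e fun _ _ => 1)) +
    (-(s / 12)) • tensorMat e (diagTensor e fun _ _ => 1) +
    (c / 4) • (ricciPairMat e R s * (ricciPairMat e R s *
      tensorMat e (diagTensor e fun _ _ => 1)))

section Conjugation

variable {n : Type*} [Fintype n] [DecidableEq n]

theorem conj_mul {P : Matrix n n ℝ} (hP : P.transpose * P = 1) (X Y : Matrix n n ℝ) :
    P.transpose * (X * Y) * P = P.transpose * X * P * (P.transpose * Y * P) := by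
  have h := mul_eq_one_comm.1 hP
  calc _ = P.transpose * X * (P * P.transpose) * Y * P := by
        rw [h, Matrix.mul_one]; simp only [Matrix.mul_assoc]
    _ = _ := by simp only [Matrix.mul_assoc]

theorem trace_conj {P : Matrix n n ℝ} (hP : P.transpose * P = 1) (X : Matrix n n ℝ) :
    (P.transpose * X * P).trace = X.trace := by
  rw [Matrix.trace_mul_comm, ← Matrix.mul_assoc, mul_eq_one_comm.1 hP, Matrix.one_mul]

end Conjugation

theorem ricciFree_isometry (e : OrthonormalBasis (Fin 4) ℝ V) {R R' : FourTensor V}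
    {U : V ≃ₗᵢ[ℝ] V} (h : ∀ a b c d, R' (U a) (U b) (U c) (U d) = R a b c d) (s : ℝ) :
    ricciMat e R - (s / 4) • (1 : Matrix (Fin 4) (Fin 4) ℝ) = (isomMat e U).transpose *
      (ricciMat e R' - (s / 4) • (1 : Matrix (Fin 4) (Fin 4) ℝ)) * isomMat e U := by
  rw [ricciMat_isometry e h, Matrix.mul_sub, Matrix.sub_mul, Matrix.mul_smul, Matrix.smul_mul,
    Matrix.mul_one, isomMat_transpose_mul]

theorem weylMat_isometry (e : OrthonormalBasis (Fin 4) ℝ V) {R R' : FourTensor V}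
    {U : V ≃ₗᵢ[ℝ] V} (h : ∀ a b c d, R' (U a) (U b) (U c) (U d) = R a b c d) (s c : ℝ) :
    weylMat e R s c = (isomMat e U ⊗ₖ isomMat e U).transpose * weylMat e R' s c *
      (isomMat e U ⊗ₖ isomMat e U) := by
  have hO := isomMat_transpose_mul e U
  have hP : (isomMat e U ⊗ₖ isomMat e U).transpose * (isomMat e U ⊗ₖ isomMat e U) = 1 := by
    rw [← Matrix.kroneckerMap_transpose, ← Matrix.mul_kronecker_mul, hO, Matrix.one_kronecker_one]
  have hG := tensorMat_isometry e (R := diagTensor e fun _ _ => 1)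
    (R' := diagTensor e fun _ _ => 1) (U := U) fun a b c d => by
      simp only [diagTensor_one, LinearIsometryEquiv.inner_map_map]
  have hZ : ricciPairMat e R s = (isomMat e U ⊗ₖ isomMat e U).transpose * ricciPairMat e R' s *
      (isomMat e U ⊗ₖ isomMat e U) := by
    simp only [ricciPairMat, Matrix.mul_add, Matrix.add_mul]
    rw [← Matrix.kroneckerMap_transpose, ← Matrix.mul_kronecker_mul, ← Matrix.mul_kronecker_mul,
      ← Matrix.mul_kronecker_mul, ← Matrix.mul_kronecker_mul, Matrix.mul_one, hO,
      ← ricciFree_isometry e h]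
  simp only [weylMat, Matrix.mul_add, Matrix.add_mul, Matrix.mul_smul, Matrix.smul_mul]
  rw [conj_mul hP, conj_mul hP, conj_mul hP, ← hG, ← hZ, ← tensorMat_isometry e h]

theorem ricciMat_params (e : OrthonormalBasis (Fin 4) ℝ V) {w : Fin 3 → ℝ}
    (hw : w 0 + w 1 + w 2 = 0) (t : Fin 3 → ℝ) (s : ℝ) :
    ricciMat e (diagTensor e (paramCoeff w t s)) = Matrix.diagonal
      ![t 0 + t 1 + t 2 + s / 4, t 0 - t 1 - t 2 + s / 4, -t 0 + t 1 - t 2 + s / 4,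
        -t 0 - t 1 + t 2 + s / 4] := by
  rw [ricciMat_diagTensor e fun i => by fin_cases i <;> rfl]
  congr 1
  funext i
  fin_cases i <;> simp [Fin.sum_univ_four, paramCoeff] <;> linarith

theorem ricciFree_params (e : OrthonormalBasis (Fin 4) ℝ V) {w : Fin 3 → ℝ}
    (hw : w 0 + w 1 + w 2 = 0) (t : Fin 3 → ℝ) (s : ℝ) :
    ricciMat e (diagTensor e (paramCoeff w t s)) - (s / 4) • (1 : Matrix (Fin 4) (Fin 4) ℝ) =
      Matrix.diagonal ![t 0 + t 1 + t 2, t 0 - t 1 - t 2, -t 0 + t 1 - t 2, -t 0 - t 1 + t 2] := by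
  rw [ricciMat_params e hw, Matrix.smul_one_eq_diagonal, Matrix.diagonal_sub]
  congr 1
  funext i
  fin_cases i <;> simp

/-- If `R_ijij = w_α ± t_α + s/12`, then the trace free Ricci eigenvalues satisfy `z_i + z_j =
±2t_α` with the same sign. Subtracting half of this sum and `s/12` leaves `w_α`; a quarter of its
square is `t_α²`. -/
theorem weylMat_params (e : OrthonormalBasis (Fin 4) ℝ V) {w : Fin 3 → ℝ}
    (hw : w 0 + w 1 + w 2 = 0) (t : Fin 3 → ℝ) (s c : ℝ) :
    weylMat e (diagTensor e (paramCoeff w t s)) s c =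
      pairMat (splitCoeff fun α => w α + c * t α ^ 2) := by
  set z : Fin 4 → ℝ := ![t 0 + t 1 + t 2, t 0 - t 1 - t 2, -t 0 + t 1 - t 2, -t 0 - t 1 + t 2]
    with hz
  have hK : ricciPairMat e (diagTensor e (paramCoeff w t s)) s =
      Matrix.diagonal fun p : Fin 4 × Fin 4 => (fun i j => z i + z j) p.1 p.2 := by
    rw [ricciPairMat, ricciFree_params e hw, ← Matrix.diagonal_one,
      Matrix.diagonal_kronecker_diagonal, Matrix.diagonal_kronecker_diagonal, Matrix.diagonal_add]
    simp [hz]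
  have hs : ∀ (a : ℝ) (d : Fin 4 → Fin 4 → ℝ), a • pairMat d = pairMat fun i j => a * d i j := by
    intro a d
    ext p q
    simp [pairMat, mul_assoc]
  have ha : ∀ d d' : Fin 4 → Fin 4 → ℝ, pairMat d + pairMat d' =
      pairMat fun i j => d i j + d' i j := by
    intro d d'
    ext p q
    simp [pairMat, add_mul]
  rw [weylMat, tensorMat_diagTensor, tensorMat_diagTensor, hK,
    diagonal_mul_pairMat fun i j => z i + z j, diagonal_mul_pairMat fun i j => z i + z j,
    hs, hs, hs, ha, ha, ha]
  refine pairMat_congr fun i j hij => ?_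
  fin_cases i <;> fin_cases j <;> first
    | exact absurd rfl hij
    | simp [hz, paramCoeff, splitCoeff]
      ring

/-- Isometric diagonal curvature tensors have parameters which agree up to a signed permutation. -/
theorem exists_signedPerm_of_isometry (e : OrthonormalBasis (Fin 4) ℝ V) {w t w' t' : Fin 3 → ℝ}
    {s s' : ℝ} (hw : w 0 + w 1 + w 2 = 0) (hw' : w' 0 + w' 1 + w' 2 = 0) {U : V ≃ₗᵢ[ℝ] V}
    (h : ∀ a b c d, diagTensor e (paramCoeff w' t' s') (U a) (U b) (U c) (U d) =
      diagTensor e (paramCoeff w t s) a b c d) :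
    s' = s ∧ ∃ (π : Equiv.Perm (Fin 3)) (ε : Fin 3 → ℤˣ), ε 0 * ε 1 * ε 2 = 1 ∧
      ∀ α, w' (π α) = w α ∧ t' (π α) = ((ε α : ℤ) : ℝ) * t α := by
  have hO := isomMat_transpose_mul e U
  have hP : (isomMat e U ⊗ₖ isomMat e U).transpose * (isomMat e U ⊗ₖ isomMat e U) = 1 := by
    rw [← Matrix.kroneckerMap_transpose, ← Matrix.mul_kronecker_mul, hO, Matrix.one_kronecker_one]
  have hs : s' = s := by
    have h1 := congrArg Matrix.trace (ricciMat_isometry e h)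
    rw [trace_conj hO, ricciMat_params e hw, ricciMat_params e hw', Matrix.trace_diagonal,
      Matrix.trace_diagonal] at h1
    simp [Fin.sum_univ_four] at h1
    linarith
  subst hs
  refine ⟨rfl, ?_⟩
  -- The cubes of the trace free Ricci eigenvalues sum to `24 t₀t₁t₂`.
  have ht : t' 0 * t' 1 * t' 2 = t 0 * t 1 * t 2 := by
    have h1 := ricciFree_isometry e h s'
    have h2 := congrArg (fun X => (X * (X * X)).trace) h1
    simp only [← conj_mul hO, trace_conj hO] at h2
    rw [ricciFree_params e hw, ricciFree_params e hw', Matrix.diagonal_mul_diagonal,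
      Matrix.diagonal_mul_diagonal, Matrix.diagonal_mul_diagonal, Matrix.diagonal_mul_diagonal,
      Matrix.trace_diagonal, Matrix.trace_diagonal] at h2
    simp [Fin.sum_univ_four] at h2
    linear_combination -h2 / 24
  -- With this `c`, matching the numbers `w_α + c t_α²` matches `w_α` and `t_α²` separately, by the
  -- same permutation.
  obtain ⟨c, hc⟩ := exists_generic_combination w (fun α => t α ^ 2) w' (fun α => t' α ^ 2)
  have hW := weylMat_isometry e h s' c
  have p1 := congrArg Matrix.trace hW
  have p2 := congrArg (fun X => (X * X).trace) hW
  have p3 := congrArg (fun X => (X * (X * X)).trace) hW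
  simp only [← conj_mul hP, trace_conj hP] at p1 p2 p3
  simp only [weylMat_params e hw, weylMat_params e hw', pairMat_splitCoeff_mul,
    trace_pairMat_splitCoeff] at p1 p2 p3
  obtain ⟨π, hπ⟩ := exists_perm_of_power_sums (x := fun α => w α + c * t α ^ 2)
    (y := fun α => w' α + c * t' α ^ 2) (by linarith) (by linarith) (by linarith)
  have hm := fun α => hc α (π α) (hπ α).symm
  have hprod : t' (π 0) * t' (π 1) * t' (π 2) = t 0 * t 1 * t 2 := by
    rw [← ht]
    have := Equiv.prod_comp π t'
    simpa [Fin.prod_univ_three] using this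
  obtain ⟨ε, h1, h2⟩ := exists_signs (y := fun α => t' (π α)) (fun α => (hm α).2.symm) hprod
  exact ⟨π, ε, h1, fun α => ⟨(hm α).1.symm, h2 α⟩⟩

end Invariants

/-! ### Equivalence under isometries, scalars and multiples of the metric -/

section Equivalence

variable {V : Type*} [NormedAddCommGroup V] [InnerProductSpace ℝ V]

theorem diagTensor_affine (e : OrthonormalBasis (Fin 4) ℝ V) (w t : Fin 3 → ℝ) (s r l : ℝ)
    (a b c d : V) :
    diagTensor e (paramCoeff (fun α => r * w α) (fun α => r * t α) (r * s + 12 * l)) a b c d =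
      r * diagTensor e (paramCoeff w t s) a b c d +
        l * (inner ℝ a c * inner ℝ b d - inner ℝ a d * inner ℝ b c) := by
  rw [← diagTensor_one e]
  simp only [diagTensor_apply, Finset.mul_sum, ← Finset.sum_add_distrib]
  refine Finset.sum_congr rfl fun i _ => Finset.sum_congr rfl fun j _ => ?_
  by_cases hij : i = j
  · subst hij
    ring
  · have h : paramCoeff (fun α => r * w α) (fun α => r * t α) (r * s + 12 * l) i j =
        r * paramCoeff w t s i j + l := by
      fin_cases i <;> fin_cases j <;> first
        | exact absurd rfl hij
        | simp [paramCoeff]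
          ring
    rw [h]
    ring

theorem exists_isometry_iff (e : OrthonormalBasis (Fin 4) ℝ V) {w t w' t' : Fin 3 → ℝ} {s s' : ℝ}
    (hw : w 0 + w 1 + w 2 = 0) (hw' : w' 0 + w' 1 + w' 2 = 0) :
    (∃ U : V ≃ₗᵢ[ℝ] V, ∀ a b c d,
      diagTensor e (paramCoeff w' t' s') (U a) (U b) (U c) (U d) =
        diagTensor e (paramCoeff w t s) a b c d) ↔
      s' = s ∧ ∃ σ : Equiv.Perm (Fin 4),
        ksElem w' t' = ((Equiv.Perm.sign σ : ℤ) : ℝ) • octEquiv σ • ksElem w t := by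
  constructor
  · rintro ⟨U, hU⟩
    obtain ⟨hs, π, ε, hε, h⟩ := exists_signedPerm_of_isometry e hw hw' hU
    obtain ⟨σ, hσ⟩ := exists_isSignedPermOf_signs π ε hε
    exact ⟨hs, σ, (ksElem_eq_sign_smul_iff hσ hw hw').2 h⟩
  · rintro ⟨rfl, σ, h⟩
    obtain ⟨π, ε, hσ⟩ := exists_isSignedPermOf_perm σ
    exact ⟨e.equiv e σ, diagTensor_equiv_perm e σ
      (paramCoeff_perm hσ hw hw' ((ksElem_eq_sign_smul_iff hσ hw hw').1 h) s')⟩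

theorem exists_affine_isometry_iff (e : OrthonormalBasis (Fin 4) ℝ V) {w t w' t' : Fin 3 → ℝ}
    {s s' : ℝ} (hw : w 0 + w 1 + w 2 = 0) (hw' : w' 0 + w' 1 + w' 2 = 0)
    (h : ksElem w t ≠ 0) (h' : ksElem w' t' ≠ 0) :
    EquivalentModMetricAndScalars (diagTensor e (paramCoeff w t s))
        (diagTensor e (paramCoeff w' t' s')) ↔
      ∃ σ : Equiv.Perm (Fin 4), Projectivization.mk ℝ (ksElem w' t') h' =
        octEquiv σ • Projectivization.mk ℝ (ksElem w t) h := by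
  have hsum : ∀ r : ℝ, r * w 0 + r * w 1 + r * w 2 = 0 := fun r => by linear_combination r * hw
  have hsign : ∀ σ : Equiv.Perm (Fin 4),
      ((Equiv.Perm.sign σ : ℤ) : ℝ) * ((Equiv.Perm.sign σ : ℤ) : ℝ) = 1 := fun σ => by
    exact_mod_cast sign_mul_self σ
  constructor
  · rintro ⟨U, r, l, -, hU⟩
    -- Scaling by `r` and adding `l` times the metric tensor changes the parameters to `(r w, r t, r
    -- s + 12 l)`, so plain isometry equivalence applies.
    obtain ⟨-, σ, hσ⟩ := (exists_isometry_iff e (s := r * s + 12 * l) (s' := s')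
      (t := fun α => r * t α) (hsum r) hw').1
      ⟨U, fun a b c d => by rw [hU, diagTensor_affine]⟩
    refine ⟨σ, ?_⟩
    rw [Projectivization.smul_mk, Projectivization.mk_eq_mk_iff']
    refine ⟨((Equiv.Perm.sign σ : ℤ) : ℝ) * r, ?_⟩
    rw [hσ, ksElem_smul, smul_comm (octEquiv σ) r, smul_smul]
  · rintro ⟨σ, hσ⟩
    rw [Projectivization.smul_mk, Projectivization.mk_eq_mk_iff'] at hσ
    obtain ⟨a, ha⟩ := hσ
    have ha0 : a ≠ 0 := by
      rintro rfl
      exact h' (by rw [← ha, zero_smul])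
    -- The sign character is absorbed into the scalar, which is why it disappears projectively.
    set r := ((Equiv.Perm.sign σ : ℤ) : ℝ) * a with hr
    obtain ⟨U, hU⟩ := (exists_isometry_iff e (s := s') (s' := s') (t := fun α => r * t α)
      (t' := t') (hsum r) hw').2 ⟨rfl, σ, by
        rw [ksElem_smul, smul_comm (octEquiv σ) r, smul_smul, hr, ← mul_assoc, hsign, one_mul, ha]⟩
    -- The multiple of the metric tensor is fixed by `r s + 12 l = s'`.
    refine ⟨U, r, (s' - r * s) / 12, mul_ne_zero (left_ne_zero_of_mul_eq_one (hsign σ)) ha0,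
      fun a b c d => ?_⟩
    rw [hU, ← diagTensor_affine]
    congr 6
    ring

end Equivalence

end SphereKilling

theorem theorem2 {V : Type*} [NormedAddCommGroup V] [InnerProductSpace ℝ V]
    (e : OrthonormalBasis (Fin 4) ℝ V) :
    -- diagonal algebraic curvature tensors are parametrised by `(w, t, s)`, `w₁ + w₂ + w₃ = 0`
    (∀ R : FourTensor V, IsAlgCurv R → IsDiagonal e R →
      ∃! p : (Fin 3 → ℝ) × (Fin 3 → ℝ) × ℝ, HasParams e R p.1 p.2.1 p.2.2) ∧
    (∀ (w t : Fin 3 → ℝ) (s : ℝ), w 0 + w 1 + w 2 = 0 →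
      ∃! R : FourTensor V, IsAlgCurv R ∧ IsDiagonal e R ∧ HasParams e R w t s) ∧
    -- every algebraic curvature tensor belongs to a Killing tensor
    (∀ R : FourTensor V, IsAlgCurv R →
      ∃! K : EndoField V, IsKillingTensor K ∧ IsCurvatureOf R K) ∧
    -- integrability in the diagonal case
    (∀ (K : EndoField V) (R : FourTensor V) (w t : Fin 3 → ℝ) (s : ℝ),
      IsKillingTensor K → IsAlgCurv R → IsCurvatureOf R K →
      IsDiagonal e R → HasParams e R w t s →
      (IsIntegrable K ↔ (ksMatrix w t).trace = 0 ∧ (ksMatrix w t).det = 0)) ∧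
    -- the matrices of integrable Killing tensors define the variety `ksVariety` ...
    ksVariety = {p | ∃ (K : EndoField V) (R : FourTensor V) (w t : Fin 3 → ℝ) (s : ℝ),
      IsKillingTensor K ∧ IsAlgCurv R ∧ IsCurvatureOf R K ∧
      IsDiagonal e R ∧ HasParams e R w t s ∧ IsIntegrable K ∧
      ∃ h : ksElem w t ≠ 0, p = Projectivization.mk ℝ (ksElem w t) h} ∧
    -- ... which is the zero locus of a cubic form in a projective space of dimension 4
    (∃ (b : Module.Basis (Fin 5) ℝ ksSpace) (f : MvPolynomial (Fin 5) ℝ),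
      f ≠ 0 ∧ f.IsHomogeneous 3 ∧ ∀ (M : ksSpace) (h : M ≠ 0),
        Projectivization.mk ℝ M h ∈ ksVariety ↔ MvPolynomial.eval (b.repr M) f = 0) ∧
    -- the action of `S₄`, and equivalence under the isometry group
    ∃ φ : Equiv.Perm (Fin 4) ≃* octGroup,
      (∀ (σ : Equiv.Perm (Fin 4)) (p : ℙ ℝ ksSpace), p ∈ ksVariety → φ σ • p ∈ ksVariety) ∧
      (∀ (R R' : FourTensor V) (w t w' t' : Fin 3 → ℝ) (s s' : ℝ),
        IsAlgCurv R → IsDiagonal e R → HasParams e R w t s →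
        IsAlgCurv R' → IsDiagonal e R' → HasParams e R' w' t' s' →
        ((IsometryEquivalent R R' ↔ s' = s ∧ ∃ σ : Equiv.Perm (Fin 4),
            ksElem w' t' = ((Equiv.Perm.sign σ : ℤ) : ℝ) • φ σ • ksElem w t) ∧
          ∀ (h : ksElem w t ≠ 0) (h' : ksElem w' t' ≠ 0),
            (EquivalentModMetricAndScalars R R' ↔ ∃ σ : Equiv.Perm (Fin 4),
              Projectivization.mk ℝ (ksElem w' t') h' =
                φ σ • Projectivization.mk ℝ (ksElem w t) h))) := by
  refine ⟨fun R _ _ => existsUnique_params e R, fun w t s hw => existsUnique_diagonal e hw t s,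
    fun R hR => existsUnique_killingTensor e hR, fun K R w t s _ hR hK hd hp => ?_,
    ksVariety_eq e, exists_cubic, octEquiv, fun σ p hp => octEquiv_smul_mem_ksVariety σ hp,
    fun R R' w t w' t' s s' hR hd hp hR' hd' hp' => ?_⟩
  · rw [isIntegrable_iff hR hK hd hp]
    exact ⟨fun h => ⟨ksMatrix_trace w t, h⟩, fun h => h.2⟩
  · rw [hp.eq_diagTensor hR hd, hp'.eq_diagTensor hR' hd']
    exact ⟨exists_isometry_iff e hp.sum_zero hp'.sum_zero,
      fun h h' => exists_affine_isometry_iff e hp.sum_zero hp'.sum_zero h h'⟩
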